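/- **Setting.** Let $\partial_t q+\partial_x F(q)+\partial_y G(q)=0$ be a system of $\nu$ conservation laws in two space dimensions, and let $q=Q(v)$ be an invertible change to physical variables $v\in\Omega_V$ ($\Omega_V\subset\mathbb R^\nu$ open and convex; $Q$, $F$, $G$ differentiable at the admissible states). Put $T^{-1}(v)=\partial Q/\partial v$ (assumed invertible), $A_V=T\,\frac{\partial F}{\partial q}\,T^{-1}$, $B_V=T\,\frac{\partial G}{\partial q}\,T^{-1}$; assume that $T$ (as a function of $q$) and $T^{-1},A_V,B_V$ (as functions of $v$) are Lipschitz continuous, and that the system is (strongly) hyperbolic: for every $v\in\Omega_V$ and every unit vector $n$ the matrix $[A_V,B_V]\cdot n$ is diagonalizable over $\mathbb R$, with eigenvector matrices that are bounded together with their inverses, uniformly in $v,n$. For $M=R\,\mathrm{diag}(d)R^{-1}$ let $M^-=R\,\mathrm{diag}(\min(d,0))R^{-1}$, and put $$D(a,b)\cdot n=\int_0^1\big([A_V,B_V](a+s(b-a))\cdot n\big)^-ds\;(b-a).$$ **Mesh and scheme.** A bounded domain $\Omega\subset\mathbb R^2$ is divided into polygonal cells $\omega_i$, each a union of triangular subcells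 $\tau=\tau_{i,\alpha}$ with barycenters $x_\tau$ and diameters $h_\tau$, the subcells forming a conforming triangulation; $h=\max_\tau h_\tau$. On each subcell the discrete solution $v_h^n$ is a $C^1$ function (e.g. a polynomial or a constant) with average $v_\tau^n$. The local predictor on $\tau$ is $$\tilde v_\tau(x,y,t)=v_\tau^n-\big(A_V(v_\tau^n)S_x+B_V(v_\tau^n)S_y\big)(t-t^n)+S_x(x-x_\tau)+S_y(y-y_\tau),$$ where the slopes $S_x,S_y$ are given, variable by variable, by ENO reconstruction: among the linear polynomials that interpolate the averages of $\tau$ and of a candidate pair of subcells sharing a vertex with $\tau$, take one that minimizes $S_x^2+S_y^2$. With $\Delta t=t^{n+1}-t^n$, $x_{\tau,k}$, $|\partial\tau_k|$, $n_k$ the midpoint, length and outward unit normal of the $k$-th edge of $\tau$, and $\tilde v^-$, $\tilde v^+$ the inner and outer traces of the predictor (on $\partial\Omega$ the outer trace is prescribed boundary data, a first degree polynomial in space-time on each edge and time slab), the path-conservative subcell MUSCL–Hancock update is $v_h^{n+1}=v_h^n+\frac{\Delta t}{|\tau|}\delta v_\tau$ on $\tau$, where $$\delta v_\tau=-|\tau|\big(A_V(\tilde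 v_\tau(x_\tau,t^{n+1/2}))S_x+B_V(\tilde v_\tau(x_\tau,t^{n+1/2}))S_y\big)-\sum_{k=1}^3|\partial\tau_k|\,D\big(\tilde v^-(x_{\tau,k},t^{n+1/2}),\tilde v^+(x_{\tau,k},t^{n+1/2})\big)\cdot n_k .$$ All states that occur are assumed admissible. For a numerical flux $\mathbf F_n(v^-,v^+)$ let $F_{\tau,k}=\frac1{\Delta t}\int_{t^n}^{t^{n+1}}\!\int_{\partial\tau_k}\mathbf F_{n_k}(\tilde v^-,\tilde v^+)\,dS\,dt$, let $\bar q^n_\tau$, $\bar q^n_i$ be the averages of $Q(v_h^n)$ over $\tau$ and $\omega_i$, and define the subcell defect $$\Delta_\tau^n=\frac1{|\tau|\,\Delta t}\Big(\int_\tau Q\big(v_h^n+\tfrac{\Delta t}{|\tau|}\delta v_\tau\big)dx-\int_\tau Q(v_h^n)\,dx\Big)+\frac1{|\tau|}\sum_{k=1}^3F_{\tau,k}.$$ **Smoothness bounds on $\tau$ at level $n$.** For some open ball $B_\tau$ around $x_\tau$ containing $\partial\tau$, $$\max_{x\in B_\tau}\max\big(\|v_h^n(x)-v_h^n(x_\tau)\|,\;h_\tau\|\nabla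 v_h^n(x)\|\big)\le C\,h_\tau,\qquad \|v_h^n(x^+)-v_h^n(x^-)\|\le C_\partial h_\tau\quad\forall x\in\partial\tau,$$ where on $\partial\Omega$ the outer value is the boundary data in the time slab. We say that $v_h^n$ is smooth around $\tau$ if these bounds hold on every subcell whose data enter the update on $\tau$ (the subcells sharing a vertex with $\tau$ or with an edge-neighbour of $\tau$). **Statement.** There is a numerical flux $\mathbf F_n(v^-,v^+)$, depending only on the system, which is consistent ($\mathbf F_n(v,v)=F(Q(v))n_x+G(Q(v))n_y$), Lipschitz continuous on bounded sets of admissible states, and conservative ($\mathbf F_{-n}(w,v)=-\mathbf F_n(v,w)$), such that the following holds for all constants $C,C_\partial,\sigma>0,\kappa,b$ and every sequence of meshes of $\Omega$ with $h\to0$ that are shape regular ($|\tau|\ge\sigma h_\tau^2$, and each $\tau$ has a candidate reconstruction stencil $\{\tau,\tau_1,\tau_2\}$ with $|\det(x_{\tau_1}-x_\tau,\,x_{\tau_2}-x_\tau)|\ge\sigma(h_\tau+h_{\tau_1}+h_{\tau_2})^2$), with discrete solutions of the above scheme that are bounded by $b$ and satisfy the CFL-type condition $\Delta t\le\kappa h_\tau$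 for all $\tau$. 1. For all $n$ and $\tau$: $\;|\tau|\dfrac{\bar q_\tau^{n+1}-\bar q_\tau^n}{\Delta t}+\sum_{k}F_{\tau,k}=|\tau|\,\Delta_\tau^n$; and $\Delta_\tau^n=o(1)$ as $h\to0$, uniformly over all $n,\tau$ such that $v_h^n$ is smooth around $\tau$. 2. For all $n$ and $i$: $\;|\omega_i|\dfrac{\bar q_i^{n+1}-\bar q_i^n}{\Delta t}+\sum_{\ell}F_{\ell}=|\omega_i|\,\Delta_i^n$ with $\Delta_i^n=\sum_{\alpha}\frac{|\tau_{i,\alpha}|}{|\omega_i|}\Delta^n_{\tau_{i,\alpha}}$, where $\ell$ runs only over the subcell edges on $\partial\omega_i$; and $\Delta_i^n=o(1)$, uniformly over all $n,i$ such that $v_h^n$ is smooth around every subcell of $\omega_i$. 3. If the smoothness bounds hold on all subcells at all levels, the scheme is quasi-conservative: its cell averages satisfy the local conservation statement in 2 with a numerical flux of the above kind, up to defects with $\sup_{i,n}\|\Delta_i^n\|\to0$. -/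

import Mathlib

open MeasureTheory Filter Topology

noncomputable section

namespace QuasiCons

/-- State vectors of a system of `ν` equations. -/
abbrev State (ν : ℕ) : Type := Fin ν → ℝ

/-- Points (and vectors) of the Euclidean plane. -/
abbrev Pt : Type := EuclideanSpace ℝ (Fin 2)

/-! ### Matrices: Jacobians and the negative part -/

/-- Jacobian matrix of a map between state spaces. -/
def jac {ν : ℕ} (f : State ν → State ν) (v : State ν) : Matrix (Fin ν) (Fin ν) ℝ :=
  LinearMap.toMatrix' (fderiv ℝ f v : State ν →ₗ[ℝ] State ν)

/-- `R`, `d` form an eigenvalue decomposition `A = R diag(d) R⁻¹`. -/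
def IsEigDecomp {ν : ℕ} (A R : Matrix (Fin ν) (Fin ν) ℝ) (d : Fin ν → ℝ) : Prop :=
  IsUnit R.det ∧ A = R * Matrix.diagonal d * R⁻¹

open Classical in
/-- The negative part `A⁻ = R diag(min(d,0)) R⁻¹` of a real diagonalizable matrix
`A = R diag(d) R⁻¹` (independent of the decomposition, see `negPart_eq`). -/
def negPart {ν : ℕ} (A : Matrix (Fin ν) (Fin ν) ℝ) : Matrix (Fin ν) (Fin ν) ℝ :=
  if h : ∃ p : Matrix (Fin ν) (Fin ν) ℝ × (Fin ν → ℝ), IsEigDecomp A p.1 p.2 then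
    h.choose.1 * Matrix.diagonal (fun i => min (h.choose.2 i) 0) * h.choose.1⁻¹
  else 0

theorem negPart_eq {ν : ℕ} {A R : Matrix (Fin ν) (Fin ν) ℝ} {d : Fin ν → ℝ}
    (hA : IsEigDecomp A R d) :
    negPart A = R * Matrix.diagonal (fun i => min (d i) 0) * R⁻¹ := by
  have hex : ∃ p : Matrix (Fin ν) (Fin ν) ℝ × (Fin ν → ℝ), IsEigDecomp A p.1 p.2 := ⟨(R, d), hA⟩
  rw [negPart, dif_pos hex]
  obtain ⟨hP, hP2⟩ := hex.choose_spec
  generalize hex.choose = p at hP hP2 ⊢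
  obtain ⟨P, e⟩ := p
  obtain ⟨hR, hR2⟩ := hA
  simp only at hP hP2 ⊢
  have h1 : (P⁻¹ * R) * Matrix.diagonal d = Matrix.diagonal e * (P⁻¹ * R) := by
    have h2 : P * Matrix.diagonal e * P⁻¹ = R * Matrix.diagonal d * R⁻¹ := by rw [← hP2, ← hR2]
    calc (P⁻¹ * R) * Matrix.diagonal d
        = P⁻¹ * (R * Matrix.diagonal d * R⁻¹) * R := by
          simp only [Matrix.mul_assoc, Matrix.nonsing_inv_mul R hR, Matrix.mul_one]
      _ = P⁻¹ * (P * Matrix.diagonal e * P⁻¹) * R := by rw [h2]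
      _ = (P⁻¹ * P) * Matrix.diagonal e * (P⁻¹ * R) := by simp only [Matrix.mul_assoc]
      _ = Matrix.diagonal e * (P⁻¹ * R) := by rw [Matrix.nonsing_inv_mul P hP, Matrix.one_mul]
  have h3 : (P⁻¹ * R) * Matrix.diagonal (fun i => min (d i) 0)
      = Matrix.diagonal (fun i => min (e i) 0) * (P⁻¹ * R) := by
    ext i j
    have h4 := congrFun (congrFun h1 i) j
    rw [Matrix.mul_diagonal, Matrix.diagonal_mul] at h4 ⊢
    by_cases hz : (P⁻¹ * R) i j = 0
    · rw [hz, zero_mul, mul_zero]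
    · have h5 : d j = e i := by
        rw [mul_comm (e i)] at h4
        exact mul_left_cancel₀ hz h4
      rw [h5, mul_comm]
  calc P * Matrix.diagonal (fun i => min (e i) 0) * P⁻¹
      = P * (Matrix.diagonal (fun i => min (e i) 0) * (P⁻¹ * R)) * R⁻¹ := by
        simp only [Matrix.mul_assoc, Matrix.mul_nonsing_inv R hR, Matrix.mul_one]
    _ = P * ((P⁻¹ * R) * Matrix.diagonal (fun i => min (d i) 0)) * R⁻¹ := by rw [h3]
    _ = (P * P⁻¹) * R * Matrix.diagonal (fun i => min (d i) 0) * R⁻¹ := by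
        simp only [Matrix.mul_assoc]
    _ = R * Matrix.diagonal (fun i => min (d i) 0) * R⁻¹ := by
        rw [Matrix.mul_nonsing_inv P hP, Matrix.one_mul]

/-! ### Hyperbolic systems in physical variables -/

section Jacobians

variable {ν : ℕ} (Q F G : State ν → State ν)

/-- `T = ∂V/∂Q` at the physical state `v`, i.e. the inverse of `T⁻¹ = ∂Q/∂V`. -/
def Tmat (v : State ν) : Matrix (Fin ν) (Fin ν) ℝ := (jac Q v)⁻¹

/-- The matrix `T (∂F/∂Q) T⁻¹` at the physical state `v`; with the second flux component in
place of `F` it is the matrix of the second space direction. -/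
def quasiMat (v : State ν) : Matrix (Fin ν) (Fin ν) ℝ := Tmat Q v * jac F (Q v) * jac Q v

/-- The matrix `[A_V, B_V] · n` at the physical state `v`. -/
def dirMat (n : Pt) (v : State ν) : Matrix (Fin ν) (Fin ν) ℝ :=
  n 0 • quasiMat Q F v + n 1 • quasiMat Q G v

end Jacobians

/-- A hyperbolic system of conservation laws `∂ₜ q + ∂ₓ F(q) + ∂_y G(q) = 0` in two space
dimensions, with a change to physical variables `q = Q(v)`. -/
structure HypSystem (ν : ℕ) where
  /-- admissible physical states -/
  adm : Set (State ν)
  /-- conserved variables as a function of the physical ones -/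
  Q : State ν → State ν
  /-- first component of the flux, as a function of the conserved variables -/
  F : State ν → State ν
  /-- second component of the flux, as a function of the conserved variables -/
  G : State ν → State ν
  isOpen_adm : IsOpen adm
  convex_adm : Convex ℝ adm
  injOn_Q : Set.InjOn Q adm
  differentiable_Q : ∀ v ∈ adm, DifferentiableAt ℝ Q v
  differentiable_F : ∀ v ∈ adm, DifferentiableAt ℝ F (Q v)
  differentiable_G : ∀ v ∈ adm, DifferentiableAt ℝ G (Q v)
  invertible_jac : ∀ v ∈ adm, IsUnit (jac Q v).det
  lipschitz_T : ∃ K : ℝ, ∀ v ∈ adm, ∀ w ∈ adm, ∀ i j,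
    |Tmat Q v i j - Tmat Q w i j| ≤ K * ‖Q v - Q w‖
  lipschitz_Tinv : ∃ K : ℝ, ∀ v ∈ adm, ∀ w ∈ adm, ∀ i j,
    |jac Q v i j - jac Q w i j| ≤ K * ‖v - w‖
  lipschitz_A : ∃ K : ℝ, ∀ v ∈ adm, ∀ w ∈ adm, ∀ i j,
    |quasiMat Q F v i j - quasiMat Q F w i j| ≤ K * ‖v - w‖
  lipschitz_B : ∃ K : ℝ, ∀ v ∈ adm, ∀ w ∈ adm, ∀ i j,
    |quasiMat Q G v i j - quasiMat Q G w i j| ≤ K * ‖v - w‖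
  /-- (strong) hyperbolicity: real diagonalizability in every direction, with eigenvector
  matrices that are bounded together with their inverses -/
  hyperbolic : ∃ K : ℝ, ∀ v ∈ adm, ∀ n : Pt, ‖n‖ = 1 →
    ∃ (R : Matrix (Fin ν) (Fin ν) ℝ) (d : Fin ν → ℝ), IsEigDecomp (dirMat Q F G n v) R d ∧
      ∀ i j, |R i j| ≤ K ∧ |R⁻¹ i j| ≤ K

namespace HypSystem

variable {ν : ℕ} (S : HypSystem ν)

/-- `A_V(v)` -/
def A (v : State ν) : Matrix (Fin ν) (Fin ν) ℝ := quasiMat S.Q S.F v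

/-- `B_V(v)` -/
def B (v : State ν) : Matrix (Fin ν) (Fin ν) ℝ := quasiMat S.Q S.G v

/-- The physical flux in direction `n`, at the physical state `v`. -/
def fluxN (n : Pt) (v : State ν) : State ν := n 0 • S.F (S.Q v) + n 1 • S.G (S.Q v)

/-- `D_n⁻(a,b) = ∫₀¹ ([A_V, B_V](a + s (b - a)) · n)⁻ ds` (segment path). -/
def pathMat (n : Pt) (a b : State ν) : Matrix (Fin ν) (Fin ν) ℝ :=
  Matrix.of fun i j =>
    ∫ s in (0 : ℝ)..1, negPart (dirMat S.Q S.F S.G n (a + s • (b - a))) i j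

/-- The path-conservative fluctuation `D(a,b) · n = D_n⁻(a,b) (b - a)`. -/
def fluct (n : Pt) (a b : State ν) : State ν := (S.pathMat n a b).mulVec (b - a)

/-- Numerical fluxes `flux a b n` (inner state, outer state, unit normal) with the classical
properties: consistency, (local) Lipschitz continuity, and conservation. -/
structure IsNumericalFlux (flux : State ν → State ν → Pt → State ν) : Prop where
  consistent : ∀ v ∈ S.adm, ∀ n : Pt, ‖n‖ = 1 → flux v v n = S.fluxN n v
  lipschitz : ∀ b : ℝ, ∃ L : ℝ, ∀ v ∈ S.adm, ∀ w ∈ S.adm, ∀ v' ∈ S.adm, ∀ w' ∈ S.adm,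
    ‖v‖ ≤ b → ‖w‖ ≤ b → ‖v'‖ ≤ b → ‖w'‖ ≤ b → ∀ n : Pt, ‖n‖ = 1 →
      ‖flux v w n - flux v' w' n‖ ≤ L * (‖v - v'‖ + ‖w - w'‖)
  conservative : ∀ v ∈ S.adm, ∀ w ∈ S.adm, ∀ n : Pt, ‖n‖ = 1 → flux w v (-n) = -flux v w n

end HypSystem

/-! ### Meshes of polygonal cells with a conforming sub-triangulation -/

/-- Two-dimensional cross product. -/
def cross (u v : Pt) : ℝ := u 0 * v 1 - u 1 * v 0

/-- Barycenter of a triangle given by its vertices. -/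
def center (p : Fin 3 → Pt) : Pt := (3 : ℝ)⁻¹ • (p 0 + p 1 + p 2)

/-- The closed triangle. -/
def tri (p : Fin 3 → Pt) : Set Pt := convexHull ℝ (Set.range p)

/-- The edge opposite to vertex `k`. -/
def edge (p : Fin 3 → Pt) (k : Fin 3) : Set Pt := segment ℝ (p (k + 1)) (p (k + 2))

/-- Midpoint of the edge opposite to vertex `k`. -/
def edgeMid (p : Fin 3 → Pt) (k : Fin 3) : Pt := midpoint ℝ (p (k + 1)) (p (k + 2))

/-- Length of the edge opposite to vertex `k`. -/
def edgeLen (p : Fin 3 → Pt) (k : Fin 3) : ℝ := dist (p (k + 1)) (p (k + 2))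

/-- Outward unit normal on the edge opposite to vertex `k` of a counterclockwise triangle. -/
def normal (p : Fin 3 → Pt) (k : Fin 3) : Pt :=
  (edgeLen p k)⁻¹ • !₂[(p (k + 2) - p (k + 1)) 1, -((p (k + 2) - p (k + 1)) 0)]

/-- Area of a plane set. -/
def area (s : Set Pt) : ℝ := (volume s).toReal

/-- A mesh of the domain `Ω`: polygonal cells, each a union of triangular subcells; the
triangulation formed by all the subcells is conforming. `stencils τ` holds the candidate
stencils of the ENO reconstruction on `τ`: a pair `(τ₁, τ₂)` stands for `{τ, τ₁, τ₂}`. -/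
structure Mesh (Ω : Set Pt) where
  ncell : ℕ
  nsub : ℕ
  /-- the cell to which a subcell belongs -/
  owner : Fin nsub → Fin ncell
  owner_surj : Function.Surjective owner
  /-- vertices of the subcells, in counterclockwise order -/
  vert : Fin nsub → Fin 3 → Pt
  ccw : ∀ τ, 0 < cross (vert τ 1 - vert τ 0) (vert τ 2 - vert τ 0)
  cover : (⋃ τ, tri (vert τ)) = closure Ω
  disjoint : ∀ τ τ', τ ≠ τ' → Disjoint (interior (tri (vert τ))) (interior (tri (vert τ')))
  /-- the subcell and the edge of it on the other side of an edge; `none` on the boundary -/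
  adj : Fin nsub → Fin 3 → Option (Fin nsub × Fin 3)
  adj_symm : ∀ τ k τ' k', adj τ k = some (τ', k') → adj τ' k' = some (τ, k)
  adj_edge : ∀ τ k τ' k', adj τ k = some (τ', k') →
    vert τ' (k' + 1) = vert τ (k + 2) ∧ vert τ' (k' + 2) = vert τ (k + 1)
  adj_none : ∀ τ k, adj τ k = none → edge (vert τ) k ⊆ frontier Ω
  stencils : Fin nsub → Finset (Fin nsub × Fin nsub)
  stencils_share : ∀ τ, ∀ s ∈ stencils τ,
    (∃ k l, vert τ k = vert s.1 l) ∧ (∃ k l, vert τ k = vert s.2 l)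
  stencils_indep : ∀ τ, ∀ s ∈ stencils τ,
    cross (center (vert s.1) - center (vert τ)) (center (vert s.2) - center (vert τ)) ≠ 0

namespace Mesh

variable {Ω : Set Pt} (M : Mesh Ω)

/-- The closed subcell `τ`. -/
def cell (τ : Fin M.nsub) : Set Pt := tri (M.vert τ)

/-- Barycenter of the subcell. -/
def ctr (τ : Fin M.nsub) : Pt := center (M.vert τ)

/-- Area `|τ|` of the subcell. -/
def vol (τ : Fin M.nsub) : ℝ := area (M.cell τ)

/-- Size of the subcell. -/
def h (τ : Fin M.nsub) : ℝ := Metric.diam (M.cell τ)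

/-- The subcells of the cell `ω_i`. -/
def subs (i : Fin M.ncell) : Finset (Fin M.nsub) := Finset.univ.filter fun τ => M.owner τ = i

/-- The closed cell `ω_i`. -/
def bigCell (i : Fin M.ncell) : Set Pt := ⋃ τ ∈ M.subs i, M.cell τ

/-- The edges of the subcells of `ω_i` that lie on the boundary of `ω_i`. -/
def bdryFaces (i : Fin M.ncell) : Finset (Fin M.nsub × Fin 3) :=
  Finset.univ.filter fun f => M.owner f.1 = i ∧ ∀ g, M.adj f.1 f.2 = some g → M.owner g.1 ≠ i

/-- Mesh size. -/
def size : ℝ := ⨆ τ, M.h τ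

/-- Two subcells share a vertex (in particular, every subcell shares one with itself). -/
def ShareVertex (τ τ' : Fin M.nsub) : Prop := ∃ k l, M.vert τ k = M.vert τ' l

/-- Two subcells share an edge. -/
def ShareEdge (τ τ' : Fin M.nsub) : Prop := ∃ k l, M.adj τ k = some (τ', l)

/-- The patch of `τ`: the subcells whose data enter the update on `τ`, that is, those that share
a vertex with `τ` or with a subcell that has an edge in common with `τ`. -/
def patch (τ : Fin M.nsub) : Set (Fin M.nsub) :=
  {τ'' | ∃ τ', (τ' = τ ∨ M.ShareEdge τ τ') ∧ M.ShareVertex τ' τ''}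

/-- Shape regularity with constant `σ`: of the subcells, and of at least one candidate
reconstruction stencil of each subcell. -/
structure ShapeRegular (σ : ℝ) : Prop where
  subcell : ∀ τ, σ * M.h τ ^ 2 ≤ M.vol τ
  stencil : ∀ τ, ∃ s ∈ M.stencils τ,
    σ * (M.h τ + M.h s.1 + M.h s.2) ^ 2 ≤ |cross (M.ctr s.1 - M.ctr τ) (M.ctr s.2 - M.ctr τ)|

end Mesh

/-! ### The path-conservative subcell MUSCL-Hancock scheme -/

/-- The data of a discrete solution: `nt` time steps `dt n`; for each level `n` and each subcell
`τ` the function `vh n τ` whose restriction to `τ` is the discrete solution there (physical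
variables); the slopes; and, for each edge on the boundary of the domain, the exterior state
(boundary data), a first degree polynomial in space and time like the predictor. -/
structure DiscreteData (ν : ℕ) {Ω : Set Pt} (M : Mesh Ω) where
  nt : ℕ
  dt : ℕ → ℝ
  vh : ℕ → Fin M.nsub → Pt → State ν
  Sx : ℕ → Fin M.nsub → State ν
  Sy : ℕ → Fin M.nsub → State ν
  ghost : ℕ → Fin M.nsub → Fin 3 → (Pt × ℝ →ᵃ[ℝ] State ν)

namespace DiscreteData

variable {ν : ℕ} {Ω : Set Pt} {M : Mesh Ω} (S : HypSystem ν) (D : DiscreteData ν M)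

/-- The time levels `t^n`. -/
def time (n : ℕ) : ℝ := ∑ m ∈ Finset.range n, D.dt m

/-- The subcell average of the discrete solution. -/
def avg (n : ℕ) (τ : Fin M.nsub) : State ν := ⨍ x in M.cell τ, D.vh n τ x

/-- `(gx, gy)` is the gradient, for the component `m`, of the first degree polynomial whose
averages over `τ`, `s.1`, `s.2` are the subcell averages (the average of a first degree polynomial
is its value at the barycenter). -/
def IsCandidate (n : ℕ) (τ : Fin M.nsub) (s : Fin M.nsub × Fin M.nsub) (m : Fin ν)
    (gx gy : ℝ) : Prop :=
  gx * (M.ctr s.1 - M.ctr τ) 0 + gy * (M.ctr s.1 - M.ctr τ) 1 = D.avg n s.1 m - D.avg n τ m ∧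
  gx * (M.ctr s.2 - M.ctr τ) 0 + gy * (M.ctr s.2 - M.ctr τ) 1 = D.avg n s.2 m - D.avg n τ m

/-- ENO slopes: for each variable, a candidate that minimizes `S_x² + S_y²`. -/
def IsENO (n : ℕ) (τ : Fin M.nsub) : Prop :=
  ∀ m : Fin ν, (∃ s ∈ M.stencils τ, D.IsCandidate n τ s m (D.Sx n τ m) (D.Sy n τ m)) ∧
    ∀ s ∈ M.stencils τ, ∀ gx gy : ℝ, D.IsCandidate n τ s m gx gy →
      D.Sx n τ m ^ 2 + D.Sy n τ m ^ 2 ≤ gx ^ 2 + gy ^ 2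

/-- The local space-time predictor on the subcell `τ`. -/
def pred (n : ℕ) (τ : Fin M.nsub) (x : Pt) (t : ℝ) : State ν :=
  D.avg n τ
    - (t - D.time n) • ((S.A (D.avg n τ)).mulVec (D.Sx n τ) + (S.B (D.avg n τ)).mulVec (D.Sy n τ))
    + (x - M.ctr τ) 0 • D.Sx n τ + (x - M.ctr τ) 1 • D.Sy n τ

/-- The outer trace of the predictor on the edge `k` of `τ`: the predictor of the neighbouring
subcell, or the boundary data. -/
def outer (n : ℕ) (τ : Fin M.nsub) (k : Fin 3) (x : Pt) (t : ℝ) : State ν :=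
  match M.adj τ k with
  | some f => D.pred S n f.1 x t
  | none => D.ghost n τ k (x, t)

/-- The half time level `t^{n+1/2}`. -/
def halfTime (n : ℕ) : ℝ := D.time n + D.dt n / 2

/-- The scaled evolution operator: the update on `τ` is `vh ↦ vh + (dt / |τ|) • evol`. -/
def evol (n : ℕ) (τ : Fin M.nsub) : State ν :=
  -(M.vol τ • ((S.A (D.pred S n τ (M.ctr τ) (D.halfTime n))).mulVec (D.Sx n τ)
      + (S.B (D.pred S n τ (M.ctr τ) (D.halfTime n))).mulVec (D.Sy n τ)))
    - ∑ k : Fin 3, edgeLen (M.vert τ) k • S.fluct (normal (M.vert τ) k)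
        (D.pred S n τ (edgeMid (M.vert τ) k) (D.halfTime n))
        (D.outer S n τ k (edgeMid (M.vert τ) k) (D.halfTime n))

/-- The discrete solution is produced by the subcell path-conservative MUSCL-Hancock finite volume
scheme, and all the states that occur in it are admissible. -/
structure IsScheme : Prop where
  dt_pos : ∀ n < D.nt, 0 < D.dt n
  smooth : ∀ n ≤ D.nt, ∀ τ, ContDiff ℝ 1 (D.vh n τ)
  eno : ∀ n < D.nt, ∀ τ, D.IsENO n τ
  update : ∀ n < D.nt, ∀ τ, ∀ x ∈ M.cell τ,
    D.vh (n + 1) τ x = D.vh n τ x + (D.dt n / M.vol τ) • D.evol S n τ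
  vh_adm : ∀ n ≤ D.nt, ∀ τ, ∀ x ∈ M.cell τ, D.vh n τ x ∈ S.adm
  pred_adm : ∀ n < D.nt, ∀ τ, ∀ x ∈ M.cell τ, ∀ t ∈ Set.Icc (D.time n) (D.time (n + 1)),
    D.pred S n τ x t ∈ S.adm
  ghost_adm : ∀ n < D.nt, ∀ τ k, M.adj τ k = none → ∀ x ∈ edge (M.vert τ) k,
    ∀ t ∈ Set.Icc (D.time n) (D.time (n + 1)), D.ghost n τ k (x, t) ∈ S.adm

/-- CFL-type condition with constant `κ`. -/
def CFL (κ : ℝ) : Prop := ∀ n < D.nt, ∀ τ, D.dt n ≤ κ * M.h τ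

/-- The discrete solution is bounded by `b`. -/
def BoundedBy (b : ℝ) : Prop := ∀ n ≤ D.nt, ∀ τ, ∀ x ∈ M.cell τ, ‖D.vh n τ x‖ ≤ b

/-- The smoothness bounds on the subcell `τ` at level `n`: in a ball around the barycenter that
contains the boundary of `τ`, the (subcellwise smooth) discrete solution deviates from its value at
the barycenter by at most `C h` and has gradient at most `C`; its jumps across the boundary of `τ`
are at most `C' h`. On the boundary of the domain the jump is taken with respect to the boundary
data of the time slab. -/
structure SmoothAt (C C' : ℝ) (n : ℕ) (τ : Fin M.nsub) : Prop where
  ball : ∃ r : ℝ, frontier (M.cell τ) ⊆ Metric.ball (M.ctr τ) r ∧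
    ∀ τ', ∀ x ∈ Metric.ball (M.ctr τ) r ∩ M.cell τ',
      max ‖D.vh n τ' x - D.vh n τ (M.ctr τ)‖ (M.h τ * ‖fderiv ℝ (D.vh n τ') x‖) ≤ C * M.h τ
  jump : ∀ k f, M.adj τ k = some f → ∀ x ∈ edge (M.vert τ) k,
    ‖D.vh n f.1 x - D.vh n τ x‖ ≤ C' * M.h τ
  jump_bdry : ∀ k, M.adj τ k = none → ∀ x ∈ edge (M.vert τ) k,
    ∀ t ∈ Set.Icc (D.time n) (D.time (n + 1)), ‖D.ghost n τ k (x, t) - D.vh n τ x‖ ≤ C' * M.h τ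

/-- The smoothness bounds hold on all the subcells that enter the update of `τ`. -/
def SmoothAround (C C' : ℝ) (n : ℕ) (τ : Fin M.nsub) : Prop :=
  ∀ τ' ∈ M.patch τ, D.SmoothAt C C' n τ'

variable (flux : State ν → State ν → Pt → State ν)

/-- The time averaged numerical flux through the edge `k` of `τ`. -/
def faceFlux (n : ℕ) (τ : Fin M.nsub) (k : Fin 3) : State ν :=
  (D.dt n)⁻¹ • ∫ t in (D.time n)..(D.time (n + 1)), edgeLen (M.vert τ) k • ∫ s in (0 : ℝ)..1,
    flux (D.pred S n τ (AffineMap.lineMap (M.vert τ (k + 1)) (M.vert τ (k + 2)) s) t)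
      (D.outer S n τ k (AffineMap.lineMap (M.vert τ (k + 1)) (M.vert τ (k + 2)) s) t)
      (normal (M.vert τ) k)

/-- Average over the subcell of the conserved variables. -/
def qSub (n : ℕ) (τ : Fin M.nsub) : State ν := (M.vol τ)⁻¹ • ∫ x in M.cell τ, S.Q (D.vh n τ x)

/-- Average over the cell of the conserved variables. -/
def qCell (n : ℕ) (i : Fin M.ncell) : State ν :=
  (area (M.bigCell i))⁻¹ • ∑ τ ∈ M.subs i, ∫ x in M.cell τ, S.Q (D.vh n τ x)

/-- The subcell conservation defect. -/
def defectSub (n : ℕ) (τ : Fin M.nsub) : State ν :=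
  (M.vol τ)⁻¹ • (D.dt n)⁻¹ •
      ((∫ x in M.cell τ, S.Q (D.vh n τ x + (D.dt n / M.vol τ) • D.evol S n τ))
        - ∫ x in M.cell τ, S.Q (D.vh n τ x))
    + (M.vol τ)⁻¹ • ∑ k : Fin 3, D.faceFlux S flux n τ k

/-- The area-weighted cell defect. -/
def defectCell (n : ℕ) (i : Fin M.ncell) : State ν :=
  ∑ τ ∈ M.subs i, (M.vol τ / area (M.bigCell i)) • D.defectSub S flux n τ

/-- The local (quasi-)conservation property on the subcell `τ`, with defect `Δ`. -/
def BalanceSub (n : ℕ) (τ : Fin M.nsub) (Δ : State ν) : Prop :=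
  M.vol τ • (D.dt n)⁻¹ • (D.qSub S (n + 1) τ - D.qSub S n τ)
    + ∑ k : Fin 3, D.faceFlux S flux n τ k = M.vol τ • Δ

/-- The local (quasi-)conservation property on the cell `ω_i`, with defect `Δ`: only the edges on
the boundary of `ω_i` contribute. -/
def BalanceCell (n : ℕ) (i : Fin M.ncell) (Δ : State ν) : Prop :=
  area (M.bigCell i) • (D.dt n)⁻¹ • (D.qCell S (n + 1) i - D.qCell S n i)
    + ∑ f ∈ M.bdryFaces i, D.faceFlux S flux n f.1 f.2 = area (M.bigCell i) • Δ

end DiscreteData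

/-- The local quasi-conservation condition for a scheme, i.e. for the discrete solutions that it
gives on a sequence of meshes: with a numerical flux that has the classical properties, the cell
averages satisfy the local conservation statement up to defects with
`sup_{i,n} ‖Δ_i^n‖ → 0`. -/
def IsQuasiConservative {ν : ℕ} (S : HypSystem ν) (flux : State ν → State ν → Pt → State ν)
    {Ω : Set Pt} (M : ℕ → Mesh Ω) (D : ∀ j, DiscreteData ν (M j)) : Prop :=
  S.IsNumericalFlux flux ∧
    ∃ Δ : ∀ j, ℕ → Fin (M j).ncell → State ν,
      (∀ j, ∀ n < (D j).nt, ∀ i, (D j).BalanceCell S flux n i (Δ j n i)) ∧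
      ∀ ε > 0, ∀ᶠ j in atTop, ∀ n < (D j).nt, ∀ i, ‖Δ j n i‖ ≤ ε

end QuasiCons

end

open QuasiCons

/-!
The numerical flux is the physical flux at the inner state plus the fluctuation transported to
conserved variables,
`F_n(a, b) = F_n(a) + ∫₀¹ (∂Q/∂V · ([A_V, B_V] · n)⁻)(a + s (b - a)) (b - a) ds`.
It is conservative by the fundamental theorem of calculus along the segment, since `(-X)⁻ = X⁻ - X`
and `∂Q/∂V · ([A_V, B_V] · n)` is the Jacobian of the physical flux (`CoeffBound.pathInt_neg`). It is
locally Lipschitz because `X ↦ X⁻` is Lipschitz on uniformly diagonalizable matrices: in a mixed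
eigenbasis the entries of `X⁻ - Y⁻` are dominated by those of `X - Y` (`norm_negPart_sub_le`).

The balance identities are algebra once the fluxes through interior edges cancel in pairs, which is
the conservativity of the flux (`IsScheme.sum_faceFlux`).

For the defect, smoothness around a subcell makes the ENO slopes bounded, because the regular
stencil competes in the minimization (`norm_slope_le`). Hence all the states entering the update are
within `O(h)` of the subcell average (`exists_localBounds`), and every coefficient matrix may be
frozen there. The jumps across the edges are also only `O(h)`, and the ratio of edge length to area
is `O(1/h)`, so the edge fluctuations contribute at order one and have to cancel. After freezing they
do: traces are affine in space and time, so time averaged fluxes are midpoint values at the half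
time level (`norm_mean_sub_le`), and `∑ₖ |∂τₖ| nₖ = 0` and `∑ₖ |∂τₖ| nₖ ⊗ (xₖ - x_τ) = |τ| I` turn the
sum of the linearized fluxes into minus the linearized increment (`sum_midFlux`). What remains is
`O(h)`, uniformly (`exists_norm_defectSub_le`), which is stronger than `o(1)`. The cell defects are
weighted means of the subcell defects.
-/

namespace QuasiCons

section Analysis

attribute [local instance] Matrix.linftyOpNormedRing Matrix.linftyOpNormedAlgebra

/-! ### The negative part is Lipschitz on uniformly diagonalizable matrices -/

theorem abs_entry_le_norm {ν : ℕ} (A : Matrix (Fin ν) (Fin ν) ℝ) (i j : Fin ν) :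
    |A i j| ≤ ‖A‖ := by
  rw [Matrix.linfty_opNorm_def, ← Real.norm_eq_abs, ← coe_nnnorm, NNReal.coe_le_coe]
  exact (Finset.single_le_sum (f := fun j => ‖A i j‖₊) (fun _ _ => zero_le)
    (Finset.mem_univ j)).trans
    (Finset.le_sup (f := fun i => ∑ j, ‖A i j‖₊) (Finset.mem_univ i))

theorem norm_le_of_abs_entry_le {ν : ℕ} {A : Matrix (Fin ν) (Fin ν) ℝ} {c : ℝ} (hc : 0 ≤ c)
    (hA : ∀ i j, |A i j| ≤ c) : ‖A‖ ≤ ν * c := by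
  lift c to NNReal using hc
  rw [Matrix.linfty_opNorm_def, ← NNReal.coe_natCast, ← NNReal.coe_mul, NNReal.coe_le_coe]
  refine Finset.sup_le fun i _ => ?_
  calc ∑ j, ‖A i j‖₊ ≤ ∑ _j : Fin ν, c := Finset.sum_le_sum fun j _ => by
        rw [← NNReal.coe_le_coe, coe_nnnorm]; exact hA i j
    _ = ν * c := by simp

theorem mulVec_norm_le {ν : ℕ} (A : Matrix (Fin ν) (Fin ν) ℝ) (v : State ν) :
    ‖A.mulVec v‖ ≤ ‖A‖ * ‖v‖ := Matrix.linfty_opNorm_mulVec A v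

/-- `A ↦ A⁻` is Lipschitz, with a constant controlled by the eigenvector matrices: in the mixed
eigenbasis `R⁻¹ · P` the entries of `A⁻ - B⁻` and `A - B` are
`(min (d i) 0 - min (e j) 0) * (R⁻¹ P) i j` and `(d i - e j) * (R⁻¹ P) i j`. -/
theorem norm_negPart_sub_le {ν : ℕ} {A B R P : Matrix (Fin ν) (Fin ν) ℝ} {d e : Fin ν → ℝ}
    (hA : IsEigDecomp A R d) (hB : IsEigDecomp B P e) :
    ‖negPart A - negPart B‖ ≤ ν * (‖R‖ * ‖R⁻¹‖ * ‖P‖ * ‖P⁻¹‖) * ‖A - B‖ := by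
  rw [negPart_eq hA, negPart_eq hB]
  obtain ⟨hR, hA⟩ := hA
  obtain ⟨hP, hB⟩ := hB
  have key : ∀ d' e' : Fin ν → ℝ,
      R⁻¹ * (R * Matrix.diagonal d' * R⁻¹ - P * Matrix.diagonal e' * P⁻¹) * P
        = Matrix.diagonal d' * (R⁻¹ * P) - (R⁻¹ * P) * Matrix.diagonal e' := by
    intro d' e'
    rw [Matrix.mul_sub, Matrix.sub_mul]
    congr 1
    · simp only [Matrix.mul_assoc]
      rw [← Matrix.mul_assoc R⁻¹ R, Matrix.nonsing_inv_mul R hR, Matrix.one_mul]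
    · simp only [Matrix.mul_assoc, Matrix.nonsing_inv_mul P hP, Matrix.mul_one]
  set f : ℝ → ℝ := fun x => min x 0
  set X := R⁻¹ * (R * Matrix.diagonal (fun i => f (d i)) * R⁻¹
    - P * Matrix.diagonal (fun i => f (e i)) * P⁻¹) * P with hX
  have hXentry : ∀ i j, |X i j| ≤ ‖R⁻¹‖ * ‖A - B‖ * ‖P‖ := by
    intro i j
    have h1 : |X i j| ≤ |(R⁻¹ * (A - B) * P) i j| := by
      rw [hX, key, hA, hB, key]
      simp only [Matrix.sub_apply, Matrix.diagonal_mul, Matrix.mul_diagonal]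
      rw [mul_comm _ (f (e j)), mul_comm _ (e j), ← sub_mul, ← sub_mul, abs_mul, abs_mul]
      refine mul_le_mul_of_nonneg_right ?_ (abs_nonneg _)
      have := abs_min_sub_min_le_max (d i) 0 (e j) 0
      simpa using this
    refine h1.trans ((abs_entry_le_norm _ i j).trans ?_)
    exact (norm_mul_le _ _).trans (mul_le_mul_of_nonneg_right (norm_mul_le _ _) (norm_nonneg _))
  have hXn : ‖X‖ ≤ ν * (‖R⁻¹‖ * ‖A - B‖ * ‖P‖) :=
    norm_le_of_abs_entry_le (by positivity) hXentry
  have hback : R * Matrix.diagonal (fun i => f (d i)) * R⁻¹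
      - P * Matrix.diagonal (fun i => f (e i)) * P⁻¹ = R * X * P⁻¹ := by
    rw [hX]
    simp only [Matrix.mul_assoc, Matrix.mul_nonsing_inv P hP, Matrix.mul_one]
    rw [← Matrix.mul_assoc R R⁻¹, Matrix.mul_nonsing_inv R hR, Matrix.one_mul]
  calc _ = ‖R * X * P⁻¹‖ := by rw [← hback]
    _ ≤ ‖R‖ * ‖X‖ * ‖P⁻¹‖ :=
      (norm_mul_le _ _).trans (mul_le_mul_of_nonneg_right (norm_mul_le _ _) (norm_nonneg _))
    _ ≤ ‖R‖ * (ν * (‖R⁻¹‖ * ‖A - B‖ * ‖P‖)) * ‖P⁻¹‖ := by gcongr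
    _ = _ := by ring

/-- `(-A)⁻ = A⁻ - A`, i.e. `(-A)⁻ = -A⁺`. -/
theorem negPart_neg {ν : ℕ} {A R : Matrix (Fin ν) (Fin ν) ℝ} {d : Fin ν → ℝ}
    (hA : IsEigDecomp A R d) : negPart (-A) = negPart A - A := by
  have hN : IsEigDecomp (-A) R (fun i => -d i) := by
    refine ⟨hA.1, ?_⟩
    rw [← Matrix.diagonal_neg, Matrix.mul_neg, Matrix.neg_mul, ← hA.2]
  have hsub : negPart A - A = R * Matrix.diagonal (fun i => min (d i) 0) * R⁻¹
      - R * Matrix.diagonal d * R⁻¹ := by rw [negPart_eq hA, ← hA.2]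
  rw [negPart_eq hN, hsub, ← Matrix.sub_mul, ← Matrix.mul_sub, Matrix.diagonal_sub]
  congr 3
  funext i
  rcases le_total (d i) 0 with h | h
  · simp [h]
  · simp [h]

/-! ### Path integrals of matrix fields along segments -/

/-- The integral of the matrix field `M` along the segment from `a` to `b`, applied to the
displacement: `∫₀¹ M(a + s (b - a)) (b - a) ds`. -/
noncomputable def pathInt {ν : ℕ} (M : State ν → Matrix (Fin ν) (Fin ν) ℝ) (a b : State ν) :
    State ν :=
  ∫ s in (0 : ℝ)..1, (M (a + s • (b - a))).mulVec (b - a)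

/-- The matrix field `M` is bounded by `K` and `K`-Lipschitz on `U`. -/
structure LipBdd {ν : ℕ} (U : Set (State ν)) (K : ℝ)
    (M : State ν → Matrix (Fin ν) (Fin ν) ℝ) : Prop where
  bdd : ∀ v ∈ U, ‖M v‖ ≤ K
  lip : ∀ v ∈ U, ∀ w ∈ U, ‖M v - M w‖ ≤ K * ‖v - w‖

theorem LipBdd.mono {ν : ℕ} {U : Set (State ν)} {K K' : ℝ}
    {M : State ν → Matrix (Fin ν) (Fin ν) ℝ} (h : LipBdd U K M) (hK : K ≤ K') : LipBdd U K' M :=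
  ⟨fun v hv => (h.bdd v hv).trans hK,
    fun v hv w hw => (h.lip v hv w hw).trans (mul_le_mul_of_nonneg_right hK (norm_nonneg _))⟩

theorem LipBdd.mul {ν : ℕ} {U : Set (State ν)} {K K' : ℝ}
    {M N : State ν → Matrix (Fin ν) (Fin ν) ℝ} (hK : 0 ≤ K) (hK' : 0 ≤ K')
    (h : LipBdd U K M) (h' : LipBdd U K' N) :
    LipBdd U (2 * (K * K')) (fun v => M v * N v) := by
  refine ⟨fun v hv => ?_, fun v hv w hw => ?_⟩
  · have := norm_mul_le (M v) (N v)
    have h2 : ‖M v‖ * ‖N v‖ ≤ K * K' := mul_le_mul (h.bdd v hv) (h'.bdd v hv) (norm_nonneg _) hK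
    nlinarith [mul_nonneg hK hK']
  · have e : M v * N v - M w * N w = (M v - M w) * N v + M w * (N v - N w) := by noncomm_ring
    rw [e]
    calc _ ≤ ‖M v - M w‖ * ‖N v‖ + ‖M w‖ * ‖N v - N w‖ :=
          (norm_add_le _ _).trans (add_le_add (norm_mul_le _ _) (norm_mul_le _ _))
      _ ≤ (K * ‖v - w‖) * K' + K * (K' * ‖v - w‖) := by
          refine add_le_add (mul_le_mul (h.lip v hv w hw) (h'.bdd v hv) (norm_nonneg _)
            (by positivity)) (mul_le_mul (h.bdd w hw) (h'.lip v hv w hw) (norm_nonneg _) hK)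
      _ = _ := by ring

theorem segment_mem {ν : ℕ} {U : Set (State ν)} (hU : Convex ℝ U) {a b : State ν} (ha : a ∈ U)
    (hb : b ∈ U) {s : ℝ} (hs : s ∈ Set.Icc (0 : ℝ) 1) : a + s • (b - a) ∈ U :=
  hU.add_smul_sub_mem ha hb hs

theorem norm_segment_sub_le {ν : ℕ} {a b v : State ν} {r : ℝ} (ha : ‖a - v‖ ≤ r)
    (hb : ‖b - v‖ ≤ r) {s : ℝ} (hs : s ∈ Set.Icc (0 : ℝ) 1) : ‖a + s • (b - a) - v‖ ≤ r := by
  have := (convex_closedBall v r).add_smul_sub_mem (x := a) (y := b)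
    (by simpa [dist_eq_norm] using ha) (by simpa [dist_eq_norm] using hb) hs
  simpa [dist_eq_norm] using this

theorem LipBdd.continuousOn_segment {ν : ℕ} {U : Set (State ν)} (hU : Convex ℝ U) {K : ℝ}
    {M : State ν → Matrix (Fin ν) (Fin ν) ℝ} (h : LipBdd U K M) {a b : State ν} (ha : a ∈ U)
    (hb : b ∈ U) (w : State ν) :
    ContinuousOn (fun s : ℝ => (M (a + s • (b - a))).mulVec w) (Set.Icc 0 1) := by
  have hK : LipschitzOnWith (Real.toNNReal (|K| * ‖b - a‖ * ‖w‖))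
      (fun s : ℝ => (M (a + s • (b - a))).mulVec w) (Set.Icc 0 1) := by
    refine LipschitzOnWith.of_dist_le_mul fun s hs t ht => ?_
    rw [Real.coe_toNNReal _ (by positivity), dist_eq_norm, ← Matrix.sub_mulVec, dist_eq_norm]
    calc _ ≤ ‖M (a + s • (b - a)) - M (a + t • (b - a))‖ * ‖w‖ := mulVec_norm_le _ _
      _ ≤ (|K| * ‖(a + s • (b - a)) - (a + t • (b - a))‖) * ‖w‖ := by
          gcongr
          exact (h.lip _ (segment_mem hU ha hb hs) _ (segment_mem hU ha hb ht)).trans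
            (mul_le_mul_of_nonneg_right (le_abs_self K) (norm_nonneg _))
      _ = |K| * ‖b - a‖ * ‖w‖ * ‖s - t‖ := by
          rw [add_sub_add_left_eq_sub, ← sub_smul, norm_smul]; ring
  exact hK.continuousOn

theorem LipBdd.intervalIntegrable {ν : ℕ} {U : Set (State ν)} (hU : Convex ℝ U) {K : ℝ}
    {M : State ν → Matrix (Fin ν) (Fin ν) ℝ} (h : LipBdd U K M) {a b : State ν} (ha : a ∈ U)
    (hb : b ∈ U) (w : State ν) :
    IntervalIntegrable (fun s : ℝ => (M (a + s • (b - a))).mulVec w) volume 0 1 :=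
  ContinuousOn.intervalIntegrable (by
    rw [Set.uIcc_of_le zero_le_one]; exact h.continuousOn_segment hU ha hb w)

theorem norm_integral_zero_one_le {E : Type*} [NormedAddCommGroup E] [NormedSpace ℝ E]
    {f : ℝ → E} {c : ℝ} (h : ∀ s ∈ Set.Icc (0 : ℝ) 1, ‖f s‖ ≤ c) :
    ‖∫ s in (0 : ℝ)..1, f s‖ ≤ c := by
  have := intervalIntegral.norm_integral_le_of_norm_le_const (a := 0) (b := 1) (C := c) (f := f)
    (fun s hs => h s (by
      rw [Set.uIoc_of_le zero_le_one] at hs; exact Set.Ioc_subset_Icc_self hs))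
  simpa using this

/-- Freezing the coefficient matrix at a state `v` near the segment costs a second order error. -/
theorem LipBdd.norm_pathInt_sub_le {ν : ℕ} {U : Set (State ν)} (hU : Convex ℝ U) {K : ℝ}
    (hK : 0 ≤ K) {M : State ν → Matrix (Fin ν) (Fin ν) ℝ} (h : LipBdd U K M) {a b v : State ν}
    (ha : a ∈ U) (hb : b ∈ U) (hv : v ∈ U) {r : ℝ} (har : ‖a - v‖ ≤ r) (hbr : ‖b - v‖ ≤ r) :
    ‖pathInt M a b - (M v).mulVec (b - a)‖ ≤ K * r * ‖b - a‖ := by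
  have e : pathInt M a b - (M v).mulVec (b - a)
      = ∫ s in (0 : ℝ)..1, ((M (a + s • (b - a))).mulVec (b - a) - (M v).mulVec (b - a)) := by
    rw [intervalIntegral.integral_sub (h.intervalIntegrable hU ha hb _) (by simp)]
    simp [pathInt]
  rw [e]
  refine norm_integral_zero_one_le fun s hs => ?_
  rw [← Matrix.sub_mulVec]
  refine (mulVec_norm_le _ _).trans (mul_le_mul_of_nonneg_right ?_ (norm_nonneg _))
  exact (h.lip _ (segment_mem hU ha hb hs) v hv).trans
    (mul_le_mul_of_nonneg_left (norm_segment_sub_le har hbr hs) hK)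

/-- Path integrals depend Lipschitz continuously on the end points, on bounded sets. -/
theorem LipBdd.norm_pathInt_sub_pathInt_le {ν : ℕ} {U : Set (State ν)} (hU : Convex ℝ U) {K : ℝ}
    (hK : 0 ≤ K) {M : State ν → Matrix (Fin ν) (Fin ν) ℝ} (h : LipBdd U K M)
    {a b a' b' : State ν} (ha : a ∈ U) (hb : b ∈ U) (ha' : a' ∈ U) (hb' : b' ∈ U) {r : ℝ}
    (hr : ‖b - a‖ ≤ r) :
    ‖pathInt M a b - pathInt M a' b'‖ ≤ K * (r + 1) * (‖a - a'‖ + ‖b - b'‖) := by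
  have e : pathInt M a b - pathInt M a' b'
      = ∫ s in (0 : ℝ)..1, ((M (a + s • (b - a))).mulVec (b - a)
          - (M (a' + s • (b' - a'))).mulVec (b' - a')) := by
    rw [intervalIntegral.integral_sub (h.intervalIntegrable hU ha hb _)
      (h.intervalIntegrable hU ha' hb' _)]
    rfl
  have hr0 : 0 ≤ r := (norm_nonneg _).trans hr
  rw [e]
  refine norm_integral_zero_one_le fun s hs => ?_
  have hm := segment_mem hU ha hb hs
  have hm' := segment_mem hU ha' hb' hs
  have hdiff : ‖(a + s • (b - a)) - (a' + s • (b' - a'))‖ ≤ ‖a - a'‖ + ‖b - b'‖ := by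
    have e2 : (a + s • (b - a)) - (a' + s • (b' - a')) = (1 - s) • (a - a') + s • (b - b') := by
      module
    rw [e2]
    refine (norm_add_le _ _).trans ?_
    rw [norm_smul, norm_smul, Real.norm_eq_abs, Real.norm_eq_abs, abs_of_nonneg hs.1,
      abs_of_nonneg (by linarith [hs.2])]
    nlinarith [hs.1, hs.2, norm_nonneg (a - a'), norm_nonneg (b - b')]
  have e3 : (M (a + s • (b - a))).mulVec (b - a) - (M (a' + s • (b' - a'))).mulVec (b' - a')
      = (M (a + s • (b - a)) - M (a' + s • (b' - a'))).mulVec (b - a)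
        + (M (a' + s • (b' - a'))).mulVec ((b - b') - (a - a')) := by
    rw [Matrix.sub_mulVec, show (b - b') - (a - a') = (b - a) - (b' - a') by abel,
      Matrix.mulVec_sub (M (a' + s • (b' - a'))) (b - a)]
    abel
  rw [e3]
  calc _ ≤ ‖M (a + s • (b - a)) - M (a' + s • (b' - a'))‖ * ‖b - a‖
        + ‖M (a' + s • (b' - a'))‖ * ‖(b - b') - (a - a')‖ :=
        (norm_add_le _ _).trans (add_le_add (mulVec_norm_le _ _) (mulVec_norm_le _ _))
    _ ≤ K * (‖a - a'‖ + ‖b - b'‖) * r + K * (‖a - a'‖ + ‖b - b'‖) := by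
        refine add_le_add (mul_le_mul ?_ hr (norm_nonneg _) (by positivity))
          (mul_le_mul (h.bdd _ hm') ?_ (norm_nonneg _) hK)
        · exact (h.lip _ hm _ hm').trans (mul_le_mul_of_nonneg_left hdiff hK)
        · exact (norm_sub_le _ _).trans (by rw [add_comm])
    _ = _ := by ring

theorem pathInt_self {ν : ℕ} (M : State ν → Matrix (Fin ν) (Fin ν) ℝ) (a : State ν) :
    pathInt M a a = 0 := by
  simp [pathInt]

theorem pathInt_swap {ν : ℕ} (M : State ν → Matrix (Fin ν) (Fin ν) ℝ) (a b : State ν) :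
    pathInt M b a = -pathInt M a b := by
  have h := intervalIntegral.integral_comp_sub_left (a := 0) (b := 1)
    (fun s : ℝ => (M (a + s • (b - a))).mulVec (b - a)) 1
  simp only [sub_self, sub_zero] at h
  rw [pathInt, pathInt, ← h, ← intervalIntegral.integral_neg]
  congr 1
  funext s
  rw [show b + s • (a - b) = a + (1 - s) • (b - a) by module, ← Matrix.mulVec_neg, neg_sub]

/-- Fundamental theorem of calculus along a segment. -/
theorem LipBdd.pathInt_eq_sub {ν : ℕ} {U : Set (State ν)} (hU : Convex ℝ U) {K : ℝ}
    {M : State ν → Matrix (Fin ν) (Fin ν) ℝ} (h : LipBdd U K M) {f : State ν → State ν}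
    (hf : ∀ v ∈ U, ∃ L : State ν →L[ℝ] State ν, HasFDerivAt f L v ∧
      ∀ w, L w = (M v).mulVec w) {a b : State ν} (ha : a ∈ U) (hb : b ∈ U) :
    pathInt M a b = f b - f a := by
  have hd : ∀ s ∈ Set.uIcc (0 : ℝ) 1,
      HasDerivAt (fun s : ℝ => f (a + s • (b - a))) ((M (a + s • (b - a))).mulVec (b - a)) s := by
    intro s hs
    rw [Set.uIcc_of_le zero_le_one] at hs
    obtain ⟨L, hL, hLM⟩ := hf _ (segment_mem hU ha hb hs)
    have h1 : HasDerivAt (fun s : ℝ => a + s • (b - a)) (b - a) s := by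
      simpa using ((hasDerivAt_id s).smul_const (b - a)).const_add a
    have h2 := hL.comp_hasDerivAt s h1
    rw [hLM] at h2
    exact h2
  rw [pathInt, intervalIntegral.integral_eq_sub_of_hasDerivAt hd (h.intervalIntegrable hU ha hb _)]
  simp

end Analysis

section Flux

attribute [local instance] Matrix.linftyOpNormedRing Matrix.linftyOpNormedAlgebra

/-! ### Coefficient matrices on bounded sets of admissible states -/

namespace HypSystem

variable {ν : ℕ} (S : HypSystem ν)

/-- The admissible states of norm at most `b`. -/
def states (b : ℝ) : Set (State ν) := S.adm ∩ Metric.closedBall 0 b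

theorem convex_states (b : ℝ) : Convex ℝ (S.states b) :=
  S.convex_adm.inter (convex_closedBall 0 b)

theorem mem_states {b : ℝ} {v : State ν} : v ∈ S.states b ↔ v ∈ S.adm ∧ ‖v‖ ≤ b := by
  simp [states]

theorem exists_lipBdd_of_entries {M : State ν → Matrix (Fin ν) (Fin ν) ℝ}
    (h : ∃ K : ℝ, ∀ v ∈ S.adm, ∀ w ∈ S.adm, ∀ i j, |M v i j - M w i j| ≤ K * ‖v - w‖) (b : ℝ) :
    ∃ K, 0 ≤ K ∧ LipBdd (S.states b) K M := by
  obtain ⟨K, hK⟩ := h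
  have hlip : ∀ v ∈ S.states b, ∀ w ∈ S.states b, ‖M v - M w‖ ≤ ν * |K| * ‖v - w‖ := by
    intro v hv w hw
    rw [mul_assoc]
    refine norm_le_of_abs_entry_le (by positivity) fun i j => ?_
    exact (hK v hv.1 w hw.1 i j).trans
      (mul_le_mul_of_nonneg_right (le_abs_self K) (norm_nonneg _))
  rcases (S.states b).eq_empty_or_nonempty with he | ⟨v₀, hv₀⟩
  · exact ⟨0, le_rfl, by simp [he], by simp [he]⟩
  · have hb : 0 ≤ b := (norm_nonneg v₀).trans (S.mem_states.1 hv₀).2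
    refine ⟨‖M v₀‖ + ν * |K| * (2 * b) + ν * |K|, by positivity, fun v hv => ?_,
      fun v hv w hw => (hlip v hv w hw).trans ?_⟩
    · have h1 : ‖M v‖ ≤ ‖M v₀‖ + ‖M v - M v₀‖ := by
        simpa using norm_add_le (M v₀) (M v - M v₀)
      have h2 : ‖v - v₀‖ ≤ 2 * b := by
        have := norm_sub_le v v₀
        linarith [(S.mem_states.1 hv₀).2, (S.mem_states.1 hv).2]
      have h3 : ν * |K| * ‖v - v₀‖ ≤ ν * |K| * (2 * b) :=
        mul_le_mul_of_nonneg_left h2 (by positivity)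
      have h4 : 0 ≤ ν * |K| := by positivity
      linarith [hlip v hv v₀ hv₀]
    · refine mul_le_mul_of_nonneg_right ?_ (norm_nonneg _)
      have : 0 ≤ ν * |K| * (2 * b) := by positivity
      linarith [norm_nonneg (M v₀)]

theorem abs_coord_le (x : Pt) (i : Fin 2) : |x i| ≤ ‖x‖ := by
  simpa using PiLp.norm_apply_le x i

theorem lipBdd_dirMat {b K : ℝ} (hA : LipBdd (S.states b) K S.A)
    (hB : LipBdd (S.states b) K S.B) {n : Pt} (hn : ‖n‖ = 1) :
    LipBdd (S.states b) (2 * K) (dirMat S.Q S.F S.G n) := by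
  have h0 : ‖n 0‖ ≤ 1 := hn ▸ abs_coord_le n 0
  have h1 : ‖n 1‖ ≤ 1 := hn ▸ abs_coord_le n 1
  have aux : ∀ (X Y : Matrix (Fin ν) (Fin ν) ℝ) (c : ℝ), ‖X‖ ≤ c → ‖Y‖ ≤ c →
      ‖n 0 • X + n 1 • Y‖ ≤ 2 * c := by
    intro X Y c hX hY
    refine (norm_add_le _ _).trans ?_
    rw [norm_smul, norm_smul]
    have e0 := mul_le_mul h0 hX (norm_nonneg _) zero_le_one
    have e1 := mul_le_mul h1 hY (norm_nonneg _) zero_le_one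
    linarith
  refine ⟨fun v hv => aux _ _ _ (hA.bdd v hv) (hB.bdd v hv), fun v hv w hw => ?_⟩
  have e : dirMat S.Q S.F S.G n v - dirMat S.Q S.F S.G n w
      = n 0 • (S.A v - S.A w) + n 1 • (S.B v - S.B w) := by
    simp only [dirMat, A, B, smul_sub]; abel
  rw [e, mul_assoc]
  exact aux _ _ _ (hA.lip v hv w hw) (hB.lip v hv w hw)

/-- The upwind matrices `([A_V, B_V] · n)⁻` inherit boundedness and Lipschitz continuity,
uniformly in `n`, from strong hyperbolicity. -/
theorem exists_lipBdd_negPart_dirMat : ∃ κ, 0 ≤ κ ∧ ∀ b K n, 0 ≤ K → ‖n‖ = 1 →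
    LipBdd (S.states b) K (dirMat S.Q S.F S.G n) →
    LipBdd (S.states b) (κ * K) (fun v => negPart (dirMat S.Q S.F S.G n v)) := by
  obtain ⟨K₀, hK₀⟩ := S.hyperbolic
  set c : ℝ := max (ν * |K₀|) ‖(1 : Matrix (Fin ν) (Fin ν) ℝ)‖ with hc
  have hc0 : 0 ≤ c := le_max_of_le_right (norm_nonneg _)
  have hR : ∀ R : Matrix (Fin ν) (Fin ν) ℝ, (∀ i j, |R i j| ≤ K₀) → ‖R‖ ≤ c := fun R hR =>
    (norm_le_of_abs_entry_le (abs_nonneg K₀) fun i j => (hR i j).trans (le_abs_self _)).trans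
      (le_max_left _ _)
  have main : ∀ {A B R P : Matrix (Fin ν) (Fin ν) ℝ} {d e : Fin ν → ℝ}, IsEigDecomp A R d →
      IsEigDecomp B P e → ‖R‖ ≤ c → ‖R⁻¹‖ ≤ c → ‖P‖ ≤ c → ‖P⁻¹‖ ≤ c →
      ‖negPart A - negPart B‖ ≤ ν * (c * c * c * c) * ‖A - B‖ := by
    intro A B R P d e hA hB h1 h2 h3 h4
    refine (norm_negPart_sub_le hA hB).trans ?_
    gcongr
  have hzero : IsEigDecomp (0 : Matrix (Fin ν) (Fin ν) ℝ) 1 (fun _ => 0) := by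
    refine ⟨by simp, by simp⟩
  have hneg0 : negPart (0 : Matrix (Fin ν) (Fin ν) ℝ) = 0 := by
    rw [negPart_eq hzero]; simp
  refine ⟨ν * (c * c * c * c), by positivity, fun b K n hK hn hM => ⟨fun v hv => ?_,
    fun v hv w hw => ?_⟩⟩
  · obtain ⟨R, d, hd, hRK⟩ := hK₀ v hv.1 n hn
    have := main hd hzero (hR R fun i j => (hRK i j).1) (hR R⁻¹ fun i j => (hRK i j).2)
      (le_max_right _ _) (by rw [inv_one]; exact le_max_right _ _)
    rw [hneg0, sub_zero, sub_zero] at this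
    exact this.trans (mul_le_mul_of_nonneg_left (hM.bdd v hv) (by positivity))
  · obtain ⟨R, d, hd, hRK⟩ := hK₀ v hv.1 n hn
    obtain ⟨P, e, he, hPK⟩ := hK₀ w hw.1 n hn
    have := main hd he (hR R fun i j => (hRK i j).1) (hR R⁻¹ fun i j => (hRK i j).2)
      (hR P fun i j => (hPK i j).1) (hR P⁻¹ fun i j => (hPK i j).2)
    refine this.trans ?_
    rw [mul_assoc (ν * (c * c * c * c))]
    exact mul_le_mul_of_nonneg_left (hM.lip v hv w hw) (by positivity)

/-- Common bounds for the coefficient matrices on a set of states. -/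
structure CoeffBound (U : Set (State ν)) (K : ℝ) : Prop where
  nonneg : 0 ≤ K
  jac : LipBdd U K (jac S.Q)
  matA : LipBdd U K S.A
  matB : LipBdd U K S.B
  neg : ∀ n : Pt, ‖n‖ = 1 → LipBdd U K (fun v => negPart (dirMat S.Q S.F S.G n v))
  jacDir : ∀ n : Pt, ‖n‖ = 1 → LipBdd U K (fun v => QuasiCons.jac S.Q v * dirMat S.Q S.F S.G n v)
  jacNeg : ∀ n : Pt, ‖n‖ = 1 →
    LipBdd U K (fun v => QuasiCons.jac S.Q v * negPart (dirMat S.Q S.F S.G n v))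

theorem exists_coeffBound (b : ℝ) : ∃ K, S.CoeffBound (S.states b) K := by
  obtain ⟨KJ, hJ0, hJ⟩ := S.exists_lipBdd_of_entries S.lipschitz_Tinv b
  obtain ⟨KA, hA0, hA⟩ := S.exists_lipBdd_of_entries (M := S.A) S.lipschitz_A b
  obtain ⟨KB, hB0, hB⟩ := S.exists_lipBdd_of_entries (M := S.B) S.lipschitz_B b
  obtain ⟨κ, hκ0, hκ⟩ := S.exists_lipBdd_negPart_dirMat
  have hD : ∀ n : Pt, ‖n‖ = 1 → LipBdd (S.states b) (2 * (KA + KB)) (dirMat S.Q S.F S.G n) :=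
    fun n hn => S.lipBdd_dirMat (hA.mono (by linarith)) (hB.mono (by linarith)) hn
  have hN := fun n hn => hκ b _ n (by positivity) hn (hD n hn)
  have hJD := fun n hn => hJ.mul hJ0 (by positivity) (hD n hn)
  have hJN := fun n hn => hJ.mul hJ0 (by positivity) (hN n hn)
  have p2 : 0 ≤ κ * (2 * (KA + KB)) := by positivity
  have p3 : 0 ≤ 2 * (KJ * (2 * (KA + KB))) := by positivity
  have p4 : 0 ≤ 2 * (KJ * (κ * (2 * (KA + KB)))) := by positivity
  refine ⟨KJ + 2 * (KA + KB) + κ * (2 * (KA + KB)) + 2 * (KJ * (2 * (KA + KB)))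
    + 2 * (KJ * (κ * (2 * (KA + KB)))), by positivity, hJ.mono (by linarith),
    hA.mono (by linarith), hB.mono (by linarith),
    fun n hn => (hN n hn).mono (by linarith), fun n hn => (hJD n hn).mono (by linarith),
    fun n hn => (hJN n hn).mono (by linarith)⟩

theorem hasFDerivAt_Q {v : State ν} (hv : v ∈ S.adm) :
    ∃ L : State ν →L[ℝ] State ν, HasFDerivAt S.Q L v ∧ ∀ w, L w = (jac S.Q v).mulVec w :=
  ⟨_, (S.differentiable_Q v hv).hasFDerivAt, fun w => by
    rw [jac, LinearMap.toMatrix'_mulVec]; rfl⟩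

/-- The Jacobian of the physical flux, in physical variables, is `∂Q/∂V · ([A_V, B_V] · n)`. -/
theorem hasFDerivAt_fluxN (n : Pt) {v : State ν} (hv : v ∈ S.adm) :
    ∃ L : State ν →L[ℝ] State ν, HasFDerivAt (S.fluxN n) L v ∧
      ∀ w, L w = (jac S.Q v * dirMat S.Q S.F S.G n v).mulVec w := by
  have hQ := (S.differentiable_Q v hv).hasFDerivAt
  have hF := ((S.differentiable_F v hv).hasFDerivAt.comp v hQ).const_smul (n 0)
  have hG := ((S.differentiable_G v hv).hasFDerivAt.comp v hQ).const_smul (n 1)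
  refine ⟨_, hF.add hG, fun w => ?_⟩
  have hJ : ∀ X : Matrix (Fin ν) (Fin ν) ℝ,
      jac S.Q v * (Tmat S.Q v * X * jac S.Q v) = X * jac S.Q v := by
    intro X
    rw [← Matrix.mul_assoc, ← Matrix.mul_assoc, Tmat,
      Matrix.mul_nonsing_inv _ (S.invertible_jac v hv), Matrix.one_mul]
  rw [dirMat, Matrix.mul_add, Matrix.mul_smul, Matrix.mul_smul, quasiMat, quasiMat, hJ, hJ,
    Matrix.add_mulVec, Matrix.smul_mulVec, Matrix.smul_mulVec, ← Matrix.mulVec_mulVec,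
    ← Matrix.mulVec_mulVec, jac, jac, jac, LinearMap.toMatrix'_mulVec,
    LinearMap.toMatrix'_mulVec, LinearMap.toMatrix'_mulVec]
  rfl

/-! ### The numerical flux -/

/-- The numerical flux of the quasi-conservative form: the physical flux at the inner state plus
the fluctuation in conserved variables,
`F_n(a) + ∫₀¹ (∂Q/∂V · ([A_V, B_V] · n)⁻)(a + s (b - a)) (b - a) ds`. -/
noncomputable def upwindFlux (a b : State ν) (n : Pt) : State ν :=
  S.fluxN n a + pathInt (fun v => jac S.Q v * negPart (dirMat S.Q S.F S.G n v)) a b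

theorem fluxN_neg (n : Pt) (v : State ν) : S.fluxN (-n) v = -S.fluxN n v := by
  simp only [fluxN, PiLp.neg_apply, neg_smul]; abel

theorem dirMat_neg (n : Pt) (v : State ν) :
    dirMat S.Q S.F S.G (-n) v = -dirMat S.Q S.F S.G n v := by
  simp only [dirMat, PiLp.neg_apply, neg_smul]; abel

variable {S}

theorem CoeffBound.Q_sub_eq {b K : ℝ} (hK : S.CoeffBound (S.states b) K) {v w : State ν}
    (hv : v ∈ S.states b) (hw : w ∈ S.states b) :
    pathInt (QuasiCons.jac S.Q) v w = S.Q w - S.Q v :=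
  hK.jac.pathInt_eq_sub (S.convex_states b) (fun _ h => S.hasFDerivAt_Q h.1) hv hw

theorem CoeffBound.fluxN_sub_eq {b K : ℝ} (hK : S.CoeffBound (S.states b) K) {n : Pt}
    (hn : ‖n‖ = 1) {v w : State ν} (hv : v ∈ S.states b) (hw : w ∈ S.states b) :
    pathInt (fun v => QuasiCons.jac S.Q v * dirMat S.Q S.F S.G n v) v w
      = S.fluxN n w - S.fluxN n v :=
  (hK.jacDir n hn).pathInt_eq_sub (S.convex_states b) (fun _ h => S.hasFDerivAt_fluxN n h.1) hv hw

/-- In conserved variables the fluctuations towards both sides add up to the flux difference. -/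
theorem CoeffBound.pathInt_neg {b K : ℝ} (hK : S.CoeffBound (S.states b) K) {n : Pt}
    (hn : ‖n‖ = 1) {v w : State ν} (hv : v ∈ S.states b) (hw : w ∈ S.states b) :
    pathInt (fun v => QuasiCons.jac S.Q v * negPart (dirMat S.Q S.F S.G (-n) v)) v w
      = pathInt (fun v => QuasiCons.jac S.Q v * negPart (dirMat S.Q S.F S.G n v)) v w
        - (S.fluxN n w - S.fluxN n v) := by
  rw [← hK.fluxN_sub_eq hn hv hw, pathInt, pathInt, pathInt,
    ← intervalIntegral.integral_sub
      ((hK.jacNeg n hn).intervalIntegrable (S.convex_states b) hv hw _)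
      ((hK.jacDir n hn).intervalIntegrable (S.convex_states b) hv hw _)]
  refine intervalIntegral.integral_congr fun s hs => ?_
  rw [Set.uIcc_of_le zero_le_one] at hs
  obtain ⟨K₀, hK₀⟩ := S.hyperbolic
  obtain ⟨R, d, hd, -⟩ := hK₀ _ (segment_mem (S.convex_states b) hv hw hs).1 n hn
  rw [← Matrix.sub_mulVec, ← Matrix.mul_sub, dirMat_neg, negPart_neg hd]

variable (S)

theorem isNumericalFlux_upwindFlux : S.IsNumericalFlux S.upwindFlux where
  consistent v _ n _ := by rw [upwindFlux, pathInt_self, add_zero]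
  lipschitz b := by
    obtain ⟨K, hK⟩ := S.exists_coeffBound b
    have hK0 := hK.nonneg
    refine ⟨K + K * (2 * b + 1), fun v hv w hw v' hv' w' hw' bv bw bv' bw' n hn => ?_⟩
    have mv := S.mem_states.2 ⟨hv, bv⟩
    have mw := S.mem_states.2 ⟨hw, bw⟩
    have mv' := S.mem_states.2 ⟨hv', bv'⟩
    have mw' := S.mem_states.2 ⟨hw', bw'⟩
    have e : S.upwindFlux v w n - S.upwindFlux v' w' n
        = (S.fluxN n v - S.fluxN n v')
          + (pathInt (fun v => jac S.Q v * negPart (dirMat S.Q S.F S.G n v)) v w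
          - pathInt (fun v => jac S.Q v * negPart (dirMat S.Q S.F S.G n v)) v' w') := by
      simp only [upwindFlux]; abel
    have h1 : ‖S.fluxN n v - S.fluxN n v'‖ ≤ K * ‖v - v'‖ := by
      rw [← hK.fluxN_sub_eq hn mv' mv]
      refine norm_integral_zero_one_le fun s hs => (mulVec_norm_le _ _).trans ?_
      exact mul_le_mul_of_nonneg_right
        ((hK.jacDir n hn).bdd _ (segment_mem (S.convex_states b) mv' mv hs)) (norm_nonneg _)
    have h2 := (hK.jacNeg n hn).norm_pathInt_sub_pathInt_le (S.convex_states b) hK0 mv mw mv' mw'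
      (r := 2 * b) ((norm_sub_le _ _).trans (by linarith))
    rw [e]
    refine (norm_add_le _ _).trans ((add_le_add h1 h2).trans ?_)
    have := mul_nonneg hK0 (norm_nonneg (w - w'))
    nlinarith
  conservative v hv w hw n hn := by
    obtain ⟨K, hK⟩ := S.exists_coeffBound (max ‖v‖ ‖w‖)
    have mv := S.mem_states.2 ⟨hv, le_max_left ‖v‖ ‖w‖⟩
    have mw := S.mem_states.2 ⟨hw, le_max_right ‖v‖ ‖w‖⟩
    rw [upwindFlux, upwindFlux, fluxN_neg, hK.pathInt_neg hn mw mv, pathInt_swap _ v w]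
    abel

/-- The fluctuation of the scheme is the path integral of the upwind matrix. -/
theorem fluct_eq_pathInt (n : Pt) (hn : ‖n‖ = 1) {a b : State ν} (ha : a ∈ S.adm)
    (hb : b ∈ S.adm) :
    S.fluct n a b = pathInt (fun v => negPart (dirMat S.Q S.F S.G n v)) a b := by
  obtain ⟨K, hK⟩ := S.exists_coeffBound (max ‖a‖ ‖b‖)
  have ma := S.mem_states.2 ⟨ha, le_max_left ‖a‖ ‖b‖⟩
  have mb := S.mem_states.2 ⟨hb, le_max_right ‖a‖ ‖b‖⟩
  have hint := fun w => (hK.neg n hn).intervalIntegrable (S.convex_states _) ma mb w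
  have hentry : ∀ i j, IntervalIntegrable
      (fun s : ℝ => negPart (dirMat S.Q S.F S.G n (a + s • (b - a))) i j) volume 0 1 := by
    intro i j
    have := hint (Pi.single j 1)
    rw [intervalIntegrable_iff_integrableOn_Ioc_of_le zero_le_one] at this ⊢
    simpa [Matrix.mulVec_single, IntegrableOn] using this.eval i
  funext i
  have hi : pathInt (fun v => negPart (dirMat S.Q S.F S.G n v)) a b i
      = ∫ s in (0 : ℝ)..1,
        (negPart (dirMat S.Q S.F S.G n (a + s • (b - a)))).mulVec (b - a) i := by
    have h := (hint (b - a))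
    rw [intervalIntegrable_iff_integrableOn_Ioc_of_le zero_le_one] at h
    rw [pathInt, intervalIntegral.integral_of_le zero_le_one,
      intervalIntegral.integral_of_le zero_le_one]
    exact eval_integral (fun i => h.eval i) i
  rw [hi]
  simp only [fluct, pathMat, Matrix.mulVec, dotProduct, Matrix.of_apply]
  rw [intervalIntegral.integral_finsetSum fun j _ => (hentry i j).mul_const _]
  simp only [intervalIntegral.integral_mul_const]

end HypSystem

end Flux

/-! ### Geometry of a triangle -/

theorem abs_cross_le (u v : Pt) : |cross u v| ≤ ‖u‖ * ‖v‖ := by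
  rw [EuclideanSpace.norm_eq, EuclideanSpace.norm_eq, ← Real.sqrt_mul (by positivity)]
  refine Real.abs_le_sqrt ?_
  simp only [Fin.sum_univ_two, Real.norm_eq_abs, sq_abs, cross]
  nlinarith [sq_nonneg (u 0 * v 0 + u 1 * v 1)]

/-- The doubled area does not depend on the vertex from which it is computed. -/
theorem cross_rotate (p : Fin 3 → Pt) (k : Fin 3) :
    cross (p (k + 2) - p (k + 1)) (p k - p (k + 1)) = cross (p 1 - p 0) (p 2 - p 0) := by
  fin_cases k <;> simp [cross] <;> ring

theorem edgeLen_nonneg (p : Fin 3 → Pt) (k : Fin 3) : 0 ≤ edgeLen p k := dist_nonneg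

theorem edgeLen_pos {p : Fin 3 → Pt} (hp : 0 < cross (p 1 - p 0) (p 2 - p 0)) (k : Fin 3) :
    0 < edgeLen p k := by
  refine dist_pos.2 fun h => ?_
  rw [← cross_rotate p k, h] at hp
  simp [cross] at hp

theorem edgeLen_mul_normal_zero {p : Fin 3 → Pt} (hp : 0 < cross (p 1 - p 0) (p 2 - p 0))
    (k : Fin 3) : edgeLen p k * normal p k 0 = (p (k + 2)) 1 - (p (k + 1)) 1 := by
  have := (edgeLen_pos hp k).ne'
  simp [normal]
  field_simp

theorem edgeLen_mul_normal_one {p : Fin 3 → Pt} (hp : 0 < cross (p 1 - p 0) (p 2 - p 0))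
    (k : Fin 3) : edgeLen p k * normal p k 1 = (p (k + 1)) 0 - (p (k + 2)) 0 := by
  have := (edgeLen_pos hp k).ne'
  simp [normal]
  field_simp

theorem norm_normal {p : Fin 3 → Pt} (hp : 0 < cross (p 1 - p 0) (p 2 - p 0)) (k : Fin 3) :
    ‖normal p k‖ = 1 := by
  have h := edgeLen_pos hp k
  have e : ‖(!₂[(p (k + 2) - p (k + 1)) 1, -((p (k + 2) - p (k + 1)) 0)] : Pt)‖ = edgeLen p k := by
    rw [edgeLen, dist_comm, dist_eq_norm, EuclideanSpace.norm_eq, EuclideanSpace.norm_eq]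
    congr 1
    simp only [Fin.sum_univ_two, Real.norm_eq_abs, sq_abs, PiLp.sub_apply]
    simp
    ring
  rw [normal, norm_smul, e, norm_inv, Real.norm_of_nonneg h.le, inv_mul_cancel₀ h.ne']

/-- The divergence theorem for constants on a triangle: `∑ₖ |∂τₖ| nₖ = 0`. -/
theorem sum_edgeLen_mul_normal {p : Fin 3 → Pt} (hp : 0 < cross (p 1 - p 0) (p 2 - p 0)) :
    ∑ k, edgeLen p k * normal p k 0 = 0 ∧ ∑ k, edgeLen p k * normal p k 1 = 0 := by
  simp only [edgeLen_mul_normal_zero hp, edgeLen_mul_normal_one hp, Fin.sum_univ_three]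
  constructor <;> simp

/-- The divergence theorem for linear fields on a triangle:
`∑ₖ |∂τₖ| nₖ ⊗ (xₖ - x_τ) = |τ| I`, with the midpoints `xₖ` of the edges. -/
theorem sum_edgeLen_mul_normal_mul {p : Fin 3 → Pt} (hp : 0 < cross (p 1 - p 0) (p 2 - p 0)) :
    ∑ k, edgeLen p k * normal p k 0 * (edgeMid p k - center p) 0
        = cross (p 1 - p 0) (p 2 - p 0) / 2 ∧
    ∑ k, edgeLen p k * normal p k 0 * (edgeMid p k - center p) 1 = 0 ∧
    ∑ k, edgeLen p k * normal p k 1 * (edgeMid p k - center p) 0 = 0 ∧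
    ∑ k, edgeLen p k * normal p k 1 * (edgeMid p k - center p) 1
        = cross (p 1 - p 0) (p 2 - p 0) / 2 := by
  simp only [edgeLen_mul_normal_zero hp, edgeLen_mul_normal_one hp, Fin.sum_univ_three]
  refine ⟨?_, ?_, ?_, ?_⟩ <;>
    simp [cross, edgeMid, center, midpoint_eq_smul_add] <;> ring

theorem convex_tri (p : Fin 3 → Pt) : Convex ℝ (tri p) := convex_convexHull _ _

theorem isCompact_tri (p : Fin 3 → Pt) : IsCompact (tri p) :=
  Set.Finite.isCompact_convexHull ℝ (Set.finite_range p)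

theorem vertex_mem_tri (p : Fin 3 → Pt) (k : Fin 3) : p k ∈ tri p :=
  subset_convexHull _ _ (Set.mem_range_self k)

theorem edge_subset_tri (p : Fin 3 → Pt) (k : Fin 3) : edge p k ⊆ tri p :=
  (convex_tri p).segment_subset (vertex_mem_tri p _) (vertex_mem_tri p _)

theorem lineMap_mem_edge (p : Fin 3 → Pt) (k : Fin 3) {s : ℝ} (hs : s ∈ Set.Icc (0 : ℝ) 1) :
    AffineMap.lineMap (p (k + 1)) (p (k + 2)) s ∈ edge p k := by
  rw [edge, segment_eq_image_lineMap ℝ]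
  exact Set.mem_image_of_mem _ hs

theorem edgeMid_eq_lineMap (p : Fin 3 → Pt) (k : Fin 3) :
    edgeMid p k = AffineMap.lineMap (p (k + 1)) (p (k + 2)) (1 / 2 : ℝ) := by
  rw [edgeMid, midpoint, invOf_eq_inv]
  norm_num

theorem center_mem_tri (p : Fin 3 → Pt) : center p ∈ tri p := by
  have := (convex_tri p).sum_mem (t := Finset.univ) (w := fun _ : Fin 3 => (3 : ℝ)⁻¹) (z := p)
    (by simp) (by simp) fun k _ => vertex_mem_tri p k
  simpa [Fin.sum_univ_three, center, smul_add] using this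

theorem dist_le_diam_tri {p : Fin 3 → Pt} {x y : Pt} (hx : x ∈ tri p) (hy : y ∈ tri p) :
    dist x y ≤ Metric.diam (tri p) :=
  Metric.dist_le_diam_of_mem (isCompact_tri p).isBounded hx hy

theorem mem_tri_iff {p : Fin 3 → Pt} {x : Pt} :
    x ∈ tri p ↔ ∃ a b : ℝ, 0 ≤ a ∧ 0 ≤ b ∧ a + b ≤ 1 ∧
      x = p 0 + (a • (p 1 - p 0) + b • (p 2 - p 0)) := by
  constructor
  · intro hx
    have hconv : Convex ℝ {x : Pt | ∃ a b : ℝ, 0 ≤ a ∧ 0 ≤ b ∧ a + b ≤ 1 ∧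
        x = p 0 + (a • (p 1 - p 0) + b • (p 2 - p 0))} := by
      rintro _ ⟨a, b, ha, hb, hab, rfl⟩ _ ⟨c, d, hc, hd, hcd, rfl⟩ s t hs ht hst
      refine ⟨s * a + t * c, s * b + t * d, by positivity, by positivity, by nlinarith, ?_⟩
      obtain rfl : s = 1 - t := by linarith
      module
    refine convexHull_min ?_ hconv hx
    rintro _ ⟨k, rfl⟩
    fin_cases k
    · exact ⟨0, 0, by simp⟩
    · exact ⟨1, 0, by simp⟩
    · exact ⟨0, 1, by simp⟩
  · rintro ⟨a, b, ha, hb, hab, rfl⟩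
    have := (convex_tri p).sum_mem (t := Finset.univ) (w := ![1 - a - b, a, b]) (z := p)
      (by intro i _; fin_cases i <;> simp <;> linarith) (by simp [Fin.sum_univ_three]; ring)
      fun k _ => vertex_mem_tri p k
    convert this using 1
    simp only [Fin.sum_univ_three, Matrix.cons_val]
    module

theorem measurableSet_unit_triangle :
    MeasurableSet {x : ℝ × ℝ | 0 ≤ x.1 ∧ 0 ≤ x.2 ∧ x.1 + x.2 ≤ 1} :=
  ((isClosed_le continuous_const continuous_fst).inter
    ((isClosed_le continuous_const continuous_snd).inter
      (isClosed_le (continuous_fst.add continuous_snd) continuous_const))).measurableSet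

theorem volume_unit_triangle :
    volume {x : ℝ × ℝ | 0 ≤ x.1 ∧ 0 ≤ x.2 ∧ x.1 + x.2 ≤ 1} = ENNReal.ofReal (1 / 2) := by
  rw [Measure.volume_eq_prod, Measure.prod_apply measurableSet_unit_triangle]
  have hs : ∀ x : ℝ, volume (Prod.mk x ⁻¹' {x : ℝ × ℝ | 0 ≤ x.1 ∧ 0 ≤ x.2 ∧ x.1 + x.2 ≤ 1})
      = (Set.Icc (0 : ℝ) 1).indicator (fun x => ENNReal.ofReal (1 - x)) x := by
    intro x
    by_cases hx : x ∈ Set.Icc (0 : ℝ) 1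
    · rw [Set.indicator_of_mem hx]
      have : Prod.mk x ⁻¹' {x : ℝ × ℝ | 0 ≤ x.1 ∧ 0 ≤ x.2 ∧ x.1 + x.2 ≤ 1}
          = Set.Icc 0 (1 - x) := by
        ext y
        simp only [Set.mem_preimage, Set.mem_ofPred_eq, Set.mem_Icc]
        exact ⟨fun h => ⟨h.2.1, by linarith [h.2.2]⟩, fun h => ⟨hx.1, h.1, by linarith [h.2]⟩⟩
      rw [this, Real.volume_Icc, sub_zero]
    · rw [Set.indicator_of_notMem hx]
      have : Prod.mk x ⁻¹' {x : ℝ × ℝ | 0 ≤ x.1 ∧ 0 ≤ x.2 ∧ x.1 + x.2 ≤ 1} = ∅ := by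
        ext y
        simp only [Set.mem_preimage, Set.mem_ofPred_eq, Set.mem_empty_iff_false, iff_false]
        exact fun h => hx ⟨h.1, by linarith [h.2.1, h.2.2]⟩
      rw [this, measure_empty]
  simp only [hs]
  rw [lintegral_indicator measurableSet_Icc, ← ofReal_integral_eq_lintegral_ofReal]
  · congr 1
    rw [integral_Icc_eq_integral_Ioc, ← intervalIntegral.integral_of_le zero_le_one]
    rw [intervalIntegral.integral_sub (by simp) (by simp)]
    norm_num
  · exact (continuous_const.sub continuous_id).integrableOn_Icc
  · refine (ae_restrict_iff' measurableSet_Icc).2 (ae_of_all _ fun x hx => ?_)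
    simpa using hx.2

theorem area_tri {p : Fin 3 → Pt} (hp : 0 < cross (p 1 - p 0) (p 2 - p 0)) :
    area (tri p) = cross (p 1 - p 0) (p 2 - p 0) / 2 := by
  set A : Matrix (Fin 2) (Fin 2) ℝ :=
    !![(p 1 - p 0) 0, (p 2 - p 0) 0; (p 1 - p 0) 1, (p 2 - p 0) 1] with hA
  set f : Pt →ₗ[ℝ] Pt := Matrix.toLin (EuclideanSpace.basisFun (Fin 2) ℝ).toBasis
    (EuclideanSpace.basisFun (Fin 2) ℝ).toBasis A with hf
  set T : Set Pt := {x | 0 ≤ x 0 ∧ 0 ≤ x 1 ∧ x 0 + x 1 ≤ 1} with hT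
  have hfx : ∀ x : Pt, f x = x 0 • (p 1 - p 0) + x 1 • (p 2 - p 0) := by
    intro x
    ext i
    fin_cases i <;>
    simp [hf, Matrix.toLin_apply, hA, Matrix.mulVec, dotProduct, Fin.sum_univ_two] <;> ring
  have htri : tri p = (fun x => p 0 + x) '' (f '' T) := by
    ext x
    rw [mem_tri_iff, Set.image_image]
    constructor
    · rintro ⟨a, b, ha, hb, hab, rfl⟩
      exact ⟨!₂[a, b], ⟨by simpa using ha, by simpa using hb, by simpa using hab⟩, by
        simp [hfx]⟩
    · rintro ⟨y, ⟨h0, h1, h2⟩, rfl⟩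
      exact ⟨y 0, y 1, h0, h1, h2, by simp only [hfx]⟩
  have hdet : LinearMap.det f = cross (p 1 - p 0) (p 2 - p 0) := by
    rw [hf, LinearMap.det_toLin, Matrix.det_fin_two_of, cross]; ring
  have hTvol : volume T = ENNReal.ofReal (1 / 2) := by
    rw [← volume_unit_triangle]
    have h1 := (volume_preserving_finTwoArrow ℝ).comp (PiLp.volume_preserving_ofLp (Fin 2))
    have h2 := h1.measure_preimage measurableSet_unit_triangle.nullMeasurableSet
    exact h2
  rw [area, htri, Set.image_add_left, measure_preimage_add, Measure.addHaar_image_linearMap, hTvol,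
    hdet, abs_of_pos hp, ← ENNReal.ofReal_mul hp.le, ENNReal.toReal_ofReal (by positivity)]
  ring

theorem cross_opposite_le {p : Fin 3 → Pt} (k : Fin 3) {x : Pt} (hx : x ∈ tri p)
    (hp : 0 < cross (p 1 - p 0) (p 2 - p 0)) :
    cross (p (k + 2) - p (k + 1)) (x - p (k + 1)) ≤ cross (p 1 - p 0) (p 2 - p 0) := by
  have hconv : Convex ℝ {x : Pt | cross (p (k + 2) - p (k + 1)) (x - p (k + 1))
      ≤ cross (p 1 - p 0) (p 2 - p 0)} := by
    intro x hx y hy s t hs ht hst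
    simp only [Set.mem_ofPred_eq] at hx hy ⊢
    have e : cross (p (k + 2) - p (k + 1)) (s • x + t • y - p (k + 1))
        = s * cross (p (k + 2) - p (k + 1)) (x - p (k + 1))
          + t * cross (p (k + 2) - p (k + 1)) (y - p (k + 1)) := by
      obtain rfl : s = 1 - t := by linarith
      simp [cross]; ring
    rw [e]
    have := mul_le_mul_of_nonneg_left hx hs
    have := mul_le_mul_of_nonneg_left hy ht
    have e2 : s * cross (p 1 - p 0) (p 2 - p 0) + t * cross (p 1 - p 0) (p 2 - p 0)
      = cross (p 1 - p 0) (p 2 - p 0) := by rw [← add_mul, hst, one_mul]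
    linarith
  refine convexHull_min ?_ hconv hx
  rintro _ ⟨l, rfl⟩
  have h0 : cross (p (k + 2) - p (k + 1)) (p (k + 1) - p (k + 1)) = 0 := by simp [cross]
  have h1 : cross (p (k + 2) - p (k + 1)) (p (k + 2) - p (k + 1)) = 0 := by
    simp [cross]; ring
  have h2 := cross_rotate p k
  have : l = k ∨ l = k + 1 ∨ l = k + 2 := by clear h0 h1 h2 hconv; revert l k; decide
  simp only [Set.mem_ofPred_eq]
  rcases this with rfl | rfl | rfl
  · exact h2.le
  · rw [h0]; exact hp.le
  · rw [h1]; exact hp.le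

/-- The vertices are boundary points: moving a vertex away from the barycenter increases its
barycentric coordinate beyond the maximum over the triangle. -/
theorem vertex_mem_frontier {p : Fin 3 → Pt} (hp : 0 < cross (p 1 - p 0) (p 2 - p 0))
    (k : Fin 3) : p k ∈ frontier (tri p) := by
  rw [frontier, (isCompact_tri p).isClosed.closure_eq]
  refine ⟨vertex_mem_tri p k, fun hint => ?_⟩
  have hc : Continuous fun s : ℝ => p k + s • (p k - p (k + 1)) := by fun_prop
  have hev : ∀ᶠ s in 𝓝 (0 : ℝ), p k + s • (p k - p (k + 1)) ∈ tri p := by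
    have := hc.tendsto 0
    simp only [zero_smul, add_zero] at this
    exact this.eventually (mem_interior_iff_mem_nhds.1 hint)
  obtain ⟨s, hs, hs0⟩ := ((hev.filter_mono nhdsWithin_le_nhds).and
    (self_mem_nhdsWithin (s := Set.Ioi (0 : ℝ)))).exists
  have hle := cross_opposite_le k hs hp
  have e : cross (p (k + 2) - p (k + 1)) (p k + s • (p k - p (k + 1)) - p (k + 1))
      = (1 + s) * cross (p (k + 2) - p (k + 1)) (p k - p (k + 1)) := by
    simp [cross]; ring
  rw [e, cross_rotate] at hle
  have : 0 < s * cross (p 1 - p 0) (p 2 - p 0) := mul_pos hs0 hp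
  linarith

/-- If two triangles have an edge in common, with opposite orientations, the outward normals are
opposite. -/
theorem normal_opposite {p q : Fin 3 → Pt} {k l : Fin 3} (h1 : q (l + 1) = p (k + 2))
    (h2 : q (l + 2) = p (k + 1)) : edgeLen q l = edgeLen p k ∧ normal q l = -normal p k := by
  have e : edgeLen q l = edgeLen p k := by rw [edgeLen, edgeLen, h1, h2, dist_comm]
  refine ⟨e, ?_⟩
  rw [normal, normal, e, ← smul_neg, h1, h2]
  congr 1
  ext i
  fin_cases i <;> simp

/-! ### Geometry of a mesh -/

namespace Mesh

variable {Ω : Set Pt} (M : Mesh Ω)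

theorem vol_eq (τ : Fin M.nsub) :
    M.vol τ = cross (M.vert τ 1 - M.vert τ 0) (M.vert τ 2 - M.vert τ 0) / 2 :=
  area_tri (M.ccw τ)

theorem vol_pos (τ : Fin M.nsub) : 0 < M.vol τ := by
  rw [vol_eq]; exact half_pos (M.ccw τ)

theorem norm_sub_le_h {τ : Fin M.nsub} {x y : Pt} (hx : x ∈ M.cell τ) (hy : y ∈ M.cell τ) :
    ‖x - y‖ ≤ M.h τ := by
  rw [← dist_eq_norm]; exact dist_le_diam_tri hx hy

theorem ctr_mem (τ : Fin M.nsub) : M.ctr τ ∈ M.cell τ := center_mem_tri _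

theorem edgeLen_le_h (τ : Fin M.nsub) (k : Fin 3) : edgeLen (M.vert τ) k ≤ M.h τ :=
  dist_le_diam_tri (vertex_mem_tri _ _) (vertex_mem_tri _ _)

theorem vol_le (τ : Fin M.nsub) (k : Fin 3) :
    M.vol τ ≤ edgeLen (M.vert τ) k * M.h τ / 2 := by
  rw [vol_eq, ← cross_rotate _ k]
  have h1 := (le_abs_self _).trans (abs_cross_le (M.vert τ (k + 2) - M.vert τ (k + 1))
    (M.vert τ k - M.vert τ (k + 1)))
  have h2 : ‖M.vert τ (k + 2) - M.vert τ (k + 1)‖ = edgeLen (M.vert τ) k := by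
    rw [edgeLen, dist_comm, dist_eq_norm]
  have h3 : ‖M.vert τ k - M.vert τ (k + 1)‖ ≤ M.h τ :=
    M.norm_sub_le_h (vertex_mem_tri _ _) (vertex_mem_tri _ _)
  rw [h2] at h1
  have := mul_le_mul_of_nonneg_left h3 (edgeLen_nonneg (M.vert τ) k)
  linarith

theorem h_pos (τ : Fin M.nsub) : 0 < M.h τ :=
  (edgeLen_pos (M.ccw τ) 0).trans_le (M.edgeLen_le_h τ 0)

theorem h_le_size (τ : Fin M.nsub) : M.h τ ≤ M.size :=
  le_ciSup (Set.finite_range M.h).bddAbove τ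

/-- In a shape regular triangulation, subcells with a common edge have comparable sizes. -/
theorem h_le_of_adj {σ : ℝ} (hσ : 0 < σ) (hM : M.ShapeRegular σ) {τ : Fin M.nsub} {k : Fin 3}
    {f : Fin M.nsub × Fin 3} (hf : M.adj τ k = some f) : M.h f.1 ≤ σ⁻¹ * M.h τ := by
  have h1 := hM.subcell f.1
  have h2 := M.vol_le f.1 f.2
  obtain ⟨e1, e2⟩ := M.adj_edge τ k f.1 f.2 hf
  rw [(normal_opposite e1 e2).1] at h2
  have h3 := M.edgeLen_le_h τ k
  have h4 := M.h_pos f.1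
  have h5 := M.h_pos τ
  have h6 : σ * M.h f.1 * M.h f.1 ≤ M.h τ * M.h f.1 := by
    have := mul_le_mul_of_nonneg_right h3 h4.le
    nlinarith
  have h7 := le_of_mul_le_mul_right h6 h4
  rwa [inv_mul_eq_div, le_div_iff₀ hσ, mul_comm]

theorem edge_subset_cell (τ : Fin M.nsub) (k : Fin 3) : edge (M.vert τ) k ⊆ M.cell τ :=
  edge_subset_tri _ _

theorem edge_subset_cell_of_adj {τ : Fin M.nsub} {k : Fin 3} {f : Fin M.nsub × Fin 3}
    (hf : M.adj τ k = some f) : edge (M.vert τ) k ⊆ M.cell f.1 := by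
  obtain ⟨e1, e2⟩ := M.adj_edge τ k f.1 f.2 hf
  rw [edge, segment_symm, ← e1, ← e2]
  exact M.edge_subset_cell f.1 f.2

theorem vol_lt_top (τ : Fin M.nsub) : volume (M.cell τ) < ⊤ := (isCompact_tri _).measure_lt_top

theorem measurableSet_cell (τ : Fin M.nsub) : MeasurableSet (M.cell τ) :=
  (isCompact_tri _).isClosed.measurableSet

theorem volume_bigCell_lt_top (i : Fin M.ncell) : volume (M.bigCell i) < ⊤ :=
  (measure_biUnion_finset_le _ _).trans_lt (ENNReal.sum_lt_top.2 fun τ _ => M.vol_lt_top τ)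

/-- The subcells do not overlap, so their areas add up. -/
theorem sum_vol_le (i : Fin M.ncell) : ∑ τ ∈ M.subs i, M.vol τ ≤ area (M.bigCell i) := by
  have h1 : ∀ τ, volume (M.cell τ) = volume (interior (M.cell τ)) := by
    intro τ
    refine le_antisymm ?_ (measure_mono interior_subset)
    calc volume (M.cell τ) ≤ volume (interior (M.cell τ) ∪ frontier (M.cell τ)) := by
          refine measure_mono ?_
          rw [← closure_eq_interior_union_frontier]
          exact subset_closure
      _ ≤ volume (interior (M.cell τ)) + volume (frontier (M.cell τ)) := measure_union_le _ _
      _ = _ := by rw [Mesh.cell, (convex_tri _).addHaar_frontier volume, add_zero]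
  have h2 : ∑ τ ∈ M.subs i, volume (M.cell τ) ≤ volume (M.bigCell i) := by
    simp only [h1]
    rw [← measure_biUnion_finset (f := fun τ => interior (M.cell τ))
      (fun τ _ τ' _ h => M.disjoint τ τ' h) (fun τ _ => isOpen_interior.measurableSet)]
    exact measure_mono (Set.iUnion₂_mono fun τ _ => interior_subset)
  have h3 : ∑ τ ∈ M.subs i, M.vol τ = (∑ τ ∈ M.subs i, volume (M.cell τ)).toReal :=
    (ENNReal.toReal_sum fun τ _ => (M.vol_lt_top τ).ne).symm
  rw [h3]
  exact ENNReal.toReal_mono (M.volume_bigCell_lt_top i).ne h2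

theorem area_bigCell_pos (i : Fin M.ncell) : 0 < area (M.bigCell i) := by
  obtain ⟨τ, hτ⟩ := M.owner_surj i
  have hmem : τ ∈ M.subs i := by simp [subs, hτ]
  exact (M.vol_pos τ).trans_le ((Finset.single_le_sum (fun τ _ => (M.vol_pos τ).le) hmem).trans
    (M.sum_vol_le i))

end Mesh

/-! ### The balance identities -/

namespace DiscreteData

variable {ν : ℕ} {Ω : Set Pt} {M : Mesh Ω} {S : HypSystem ν} {D : DiscreteData ν M}
  {flux : State ν → State ν → Pt → State ν}

theorem time_succ (n : ℕ) : D.time (n + 1) = D.time n + D.dt n := by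
  rw [time, Finset.sum_range_succ, ← time]

theorem outer_some {n : ℕ} {τ : Fin M.nsub} {k : Fin 3} {f : Fin M.nsub × Fin 3}
    (hf : M.adj τ k = some f) (x : Pt) (t : ℝ) : D.outer S n τ k x t = D.pred S n f.1 x t := by
  rw [outer, hf]

theorem outer_none {n : ℕ} {τ : Fin M.nsub} {k : Fin 3} (hf : M.adj τ k = none) (x : Pt) (t : ℝ) :
    D.outer S n τ k x t = D.ghost n τ k (x, t) := by
  rw [outer, hf]

theorem IsScheme.outer_adm (hD : D.IsScheme S) {n : ℕ} (hn : n < D.nt) (τ : Fin M.nsub)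
    (k : Fin 3) {x : Pt} (hx : x ∈ edge (M.vert τ) k) {t : ℝ}
    (ht : t ∈ Set.Icc (D.time n) (D.time (n + 1))) : D.outer S n τ k x t ∈ S.adm := by
  rcases hf : M.adj τ k with _ | f
  · rw [outer_none hf]
    exact hD.ghost_adm n hn τ k hf x hx t ht
  · rw [outer_some hf]
    exact hD.pred_adm n hn f.1 x (M.edge_subset_cell_of_adj hf hx) t ht

theorem IsScheme.setIntegral_Q_succ (hD : D.IsScheme S) {n : ℕ} (hn : n < D.nt)
    (τ : Fin M.nsub) :
    ∫ x in M.cell τ, S.Q (D.vh n τ x + (D.dt n / M.vol τ) • D.evol S n τ)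
      = ∫ x in M.cell τ, S.Q (D.vh (n + 1) τ x) :=
  setIntegral_congr_fun (M.measurableSet_cell τ) fun x hx => by rw [hD.update n hn τ x hx]

/-- The defect, scaled by the area, as increment of the integral plus fluxes. -/
theorem IsScheme.vol_smul_defectSub (hD : D.IsScheme S) {n : ℕ} (hn : n < D.nt)
    (τ : Fin M.nsub) :
    M.vol τ • D.defectSub S flux n τ
      = (D.dt n)⁻¹ • ((∫ x in M.cell τ, S.Q (D.vh (n + 1) τ x)) - ∫ x in M.cell τ, S.Q (D.vh n τ x))
        + ∑ k : Fin 3, D.faceFlux S flux n τ k := by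
  rw [defectSub, smul_add, smul_inv_smul₀ (M.vol_pos τ).ne', smul_inv_smul₀ (M.vol_pos τ).ne',
    hD.setIntegral_Q_succ hn]

theorem IsScheme.balanceSub (hD : D.IsScheme S) {n : ℕ} (hn : n < D.nt) (τ : Fin M.nsub) :
    D.BalanceSub S flux n τ (D.defectSub S flux n τ) := by
  rw [BalanceSub, hD.vol_smul_defectSub hn, qSub, qSub, ← smul_sub, smul_comm (M.vol τ),
    smul_inv_smul₀ (M.vol_pos τ).ne']

/-- The fluxes through an edge, as seen from both sides, cancel. -/
theorem IsScheme.faceFlux_adj (hD : D.IsScheme S) (hF : S.IsNumericalFlux flux) {n : ℕ}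
    (hn : n < D.nt) {τ : Fin M.nsub} {k : Fin 3} {f : Fin M.nsub × Fin 3}
    (hf : M.adj τ k = some f) :
    D.faceFlux S flux n f.1 f.2 = -D.faceFlux S flux n τ k := by
  obtain ⟨e1, e2⟩ := M.adj_edge τ k f.1 f.2 hf
  obtain ⟨eL, eN⟩ := normal_opposite e1 e2
  have hf' := M.adj_symm τ k f.1 f.2 hf
  have hdt := hD.dt_pos n hn
  have hle : D.time n ≤ D.time (n + 1) := by rw [time_succ]; linarith
  rw [faceFlux, faceFlux, eL, eN, e1, e2, ← smul_neg, ← intervalIntegral.integral_neg]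
  congr 1
  refine intervalIntegral.integral_congr fun t ht => ?_
  rw [Set.uIcc_of_le hle] at ht
  rw [← smul_neg, ← intervalIntegral.integral_neg]
  congr 1
  have hrev := intervalIntegral.integral_comp_sub_left (a := 0) (b := 1) (fun s : ℝ =>
    -flux (D.pred S n τ (AffineMap.lineMap (M.vert τ (k + 1)) (M.vert τ (k + 2)) s) t)
      (D.outer S n τ k (AffineMap.lineMap (M.vert τ (k + 1)) (M.vert τ (k + 2)) s) t)
      (normal (M.vert τ) k)) 1
  simp only [sub_self, sub_zero] at hrev
  rw [← hrev]
  refine intervalIntegral.integral_congr fun s hs => ?_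
  rw [Set.uIcc_of_le zero_le_one] at hs
  have hs' : 1 - s ∈ Set.Icc (0 : ℝ) 1 := ⟨by linarith [hs.2], by linarith [hs.1]⟩
  have hx := lineMap_mem_edge (M.vert τ) k hs'
  rw [← AffineMap.lineMap_apply_one_sub, outer_some hf, outer_some hf']
  refine hF.conservative _ ?_ _ ?_ _ (norm_normal (M.ccw τ) k)
  · exact hD.pred_adm n hn τ _ (M.edge_subset_cell τ k hx) t ht
  · exact hD.pred_adm n hn f.1 _ (M.edge_subset_cell_of_adj hf hx) t ht

/-- Telescoping: in the sum over all the edges of the subcells of a cell only the edges on the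
boundary of the cell survive. -/
theorem IsScheme.sum_faceFlux (hD : D.IsScheme S) (hF : S.IsNumericalFlux flux) {n : ℕ}
    (hn : n < D.nt) (i : Fin M.ncell) :
    ∑ τ ∈ M.subs i, ∑ k : Fin 3, D.faceFlux S flux n τ k
      = ∑ f ∈ M.bdryFaces i, D.faceFlux S flux n f.1 f.2 := by
  classical
  set T := Finset.univ.filter fun f : Fin M.nsub × Fin 3 => M.owner f.1 = i
  set P : Fin M.nsub × Fin 3 → Prop :=
    fun f => ∀ g, M.adj f.1 f.2 = some g → M.owner g.1 ≠ i with hP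
  have h1 : ∑ τ ∈ M.subs i, ∑ k : Fin 3, D.faceFlux S flux n τ k
      = ∑ f ∈ T, D.faceFlux S flux n f.1 f.2 := by
    rw [← Finset.sum_product']
    refine Finset.sum_congr ?_ fun _ _ => rfl
    ext f
    simp [T, Mesh.subs]
  have h2 : M.bdryFaces i = T.filter P := by
    ext f
    simp [T, P, Mesh.bdryFaces]
  rw [h1, h2, ← Finset.sum_filter_add_sum_filter_not T P, add_eq_left]
  have hinner : ∀ f ∈ T.filter fun f => ¬ P f, ∃ g, M.adj f.1 f.2 = some g ∧ M.owner g.1 = i := by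
    intro f hf
    have := (Finset.mem_filter.1 hf).2
    simp only [hP] at this
    push Not at this
    exact this
  choose g hg hgi using hinner
  refine Finset.sum_involution g (fun f hf => ?_) (fun f hf hne hfix => hne ?_) (fun f hf => ?_)
    (fun f hf => ?_)
  · rw [hD.faceFlux_adj hF hn (hg f hf), add_neg_cancel]
  · have := hD.faceFlux_adj hF hn (hg f hf)
    rw [hfix] at this
    exact self_eq_neg.1 this
  · refine Finset.mem_filter.2 ⟨by simp [T, hgi f hf], fun hPg => ?_⟩
    exact hPg f (M.adj_symm _ _ _ _ (hg f hf)) (by simpa [T] using (Finset.mem_filter.1 hf).1)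
  · have hmem : g f hf ∈ T.filter fun f => ¬ P f := by
      refine Finset.mem_filter.2 ⟨by simp [T, hgi f hf], fun hPg => ?_⟩
      exact hPg f (M.adj_symm _ _ _ _ (hg f hf)) (by simpa [T] using (Finset.mem_filter.1 hf).1)
    have e1 := hg _ hmem
    rw [M.adj_symm _ _ _ _ (hg f hf)] at e1
    exact (Option.some.inj e1).symm

theorem area_smul_defectCell (n : ℕ) (i : Fin M.ncell) :
    area (M.bigCell i) • D.defectCell S flux n i
      = ∑ τ ∈ M.subs i, M.vol τ • D.defectSub S flux n τ := by
  rw [defectCell, Finset.smul_sum]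
  refine Finset.sum_congr rfl fun τ _ => ?_
  rw [smul_smul, mul_div_cancel₀ _ (M.area_bigCell_pos i).ne']

theorem IsScheme.balanceCell (hD : D.IsScheme S) (hF : S.IsNumericalFlux flux) {n : ℕ}
    (hn : n < D.nt) (i : Fin M.ncell) :
    D.BalanceCell S flux n i (D.defectCell S flux n i) := by
  rw [BalanceCell, area_smul_defectCell, qCell, qCell, ← smul_sub, smul_comm (area _),
    smul_inv_smul₀ (M.area_bigCell_pos i).ne', ← hD.sum_faceFlux hF hn, ← Finset.sum_sub_distrib,
    Finset.smul_sum, ← Finset.sum_add_distrib]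
  exact Finset.sum_congr rfl fun τ _ => (hD.vol_smul_defectSub hn τ).symm

/-- The cell defect is a weighted mean of the subcell defects. -/
theorem norm_defectCell_le {n : ℕ} {i : Fin M.ncell} {ε : ℝ} (hε : 0 ≤ ε)
    (h : ∀ τ ∈ M.subs i, ‖D.defectSub S flux n τ‖ ≤ ε) : ‖D.defectCell S flux n i‖ ≤ ε := by
  have hpos := M.area_bigCell_pos i
  calc ‖D.defectCell S flux n i‖ ≤ ∑ τ ∈ M.subs i, M.vol τ / area (M.bigCell i) * ε := by
        refine norm_sum_le_of_le _ fun τ hτ => ?_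
        have := M.vol_pos τ
        rw [norm_smul, Real.norm_of_nonneg (by positivity)]
        exact mul_le_mul_of_nonneg_left (h τ hτ) (by positivity)
    _ = (∑ τ ∈ M.subs i, M.vol τ) / area (M.bigCell i) * ε := by
        rw [← Finset.sum_mul, Finset.sum_div]
    _ ≤ 1 * ε := mul_le_mul_of_nonneg_right ((div_le_one hpos).2 (M.sum_vol_le i)) hε
    _ = ε := one_mul ε

end DiscreteData

/-! ### Space-time averages of functions close to an affine function -/

/-- If a continuous function on `[0,1] × [a,b]` is within `ε` of an affine function, its mean value
is within `ε` of the value of the affine function at the midpoint. -/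
theorem norm_mean_sub_le {E : Type*} [NormedAddCommGroup E] [NormedSpace ℝ E] [CompleteSpace E] {a b ε : ℝ}
    (hab : a < b) {f : ℝ × ℝ → E}
    (hf : ContinuousOn f (Set.Icc 0 1 ×ˢ Set.Icc a b)) {c₀ c₁ c₂ : E}
    (h : ∀ s ∈ Set.Icc (0 : ℝ) 1, ∀ t ∈ Set.Icc a b,
      ‖f (s, t) - (c₀ + s • c₁ + t • c₂)‖ ≤ ε) :
    ‖(b - a)⁻¹ • (∫ t in a..b, ∫ s in (0 : ℝ)..1, f (s, t))
      - (c₀ + (1 / 2 : ℝ) • c₁ + ((a + b) / 2) • c₂)‖ ≤ ε := by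
  -- the projection onto the rectangle makes the integrand globally continuous
  set g : ℝ → ℝ → E := fun t s =>
    f (Set.projIcc (0 : ℝ) 1 zero_le_one s, Set.projIcc a b hab.le t) with hg
  have hgc : Continuous (Function.uncurry g) := by
    refine hf.comp_continuous ?_ fun x => ⟨Subtype.coe_prop _, Subtype.coe_prop _⟩
    exact (continuous_subtype_val.comp (continuous_projIcc.comp continuous_snd)).prodMk
      (continuous_subtype_val.comp (continuous_projIcc.comp continuous_fst))
  have hgf : ∀ t ∈ Set.Icc a b, ∀ s ∈ Set.Icc (0 : ℝ) 1, f (s, t) = g t s := by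
    intro t ht s hs
    simp only [hg, Set.projIcc_of_mem _ hs, Set.projIcc_of_mem _ ht]
  have e1 : ∫ t in a..b, ∫ s in (0 : ℝ)..1, f (s, t) = ∫ t in a..b, ∫ s in (0 : ℝ)..1, g t s := by
    refine intervalIntegral.integral_congr fun t ht => intervalIntegral.integral_congr
      fun s hs => ?_
    rw [Set.uIcc_of_le hab.le] at ht
    rw [Set.uIcc_of_le zero_le_one] at hs
    exact hgf t ht s hs
  have hA : ∀ t : ℝ, ∫ s in (0 : ℝ)..1, (c₀ + s • c₁ + t • c₂)
      = c₀ + (1 / 2 : ℝ) • c₁ + t • c₂ := by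
    intro t
    rw [intervalIntegral.integral_add (Continuous.intervalIntegrable (by fun_prop) _ _)
      (by simp), intervalIntegral.integral_add (by simp)
      (Continuous.intervalIntegrable (by fun_prop) _ _), intervalIntegral.integral_smul_const]
    simp
  have hB : ∫ t in a..b, (c₀ + (1 / 2 : ℝ) • c₁ + t • c₂)
      = (b - a) • (c₀ + (1 / 2 : ℝ) • c₁ + ((a + b) / 2) • c₂) := by
    rw [intervalIntegral.integral_add (by simp)
      (Continuous.intervalIntegrable (by fun_prop) _ _), intervalIntegral.integral_smul_const]
    simp only [intervalIntegral.integral_const, integral_id]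
    module
  have hb : 0 < b - a := sub_pos.2 hab
  have hi : Continuous fun t => ∫ s in (0 : ℝ)..1, g t s :=
    intervalIntegral.continuous_parametric_intervalIntegral_of_continuous' hgc 0 1
  have e2 : (b - a)⁻¹ • (∫ t in a..b, ∫ s in (0 : ℝ)..1, f (s, t))
      - (c₀ + (1 / 2 : ℝ) • c₁ + ((a + b) / 2) • c₂)
      = (b - a)⁻¹ • ∫ t in a..b, ∫ s in (0 : ℝ)..1, (g t s - (c₀ + s • c₁ + t • c₂)) := by
    have e3 : ∀ t : ℝ, ∫ s in (0 : ℝ)..1, (g t s - (c₀ + s • c₁ + t • c₂))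
        = (∫ s in (0 : ℝ)..1, g t s) - (c₀ + (1 / 2 : ℝ) • c₁ + t • c₂) := by
      intro t
      rw [intervalIntegral.integral_sub
        (Continuous.intervalIntegrable (by fun_prop) _ _)
        (Continuous.intervalIntegrable (by fun_prop) _ _), hA]
    simp only [e3]
    rw [intervalIntegral.integral_sub (hi.intervalIntegrable _ _)
      (Continuous.intervalIntegrable (by fun_prop) _ _), hB, smul_sub, inv_smul_smul₀ hb.ne', e1]
  rw [e2, norm_smul, norm_inv, Real.norm_of_nonneg hb.le, inv_mul_le_iff₀ hb]
  have := intervalIntegral.norm_integral_le_of_norm_le_const (a := a) (b := b) (C := ε)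
    (f := fun t => ∫ s in (0 : ℝ)..1, (g t s - (c₀ + s • c₁ + t • c₂))) fun t ht => by
      rw [Set.uIoc_of_le hab.le] at ht
      have ht' := Set.Ioc_subset_Icc_self ht
      refine norm_integral_zero_one_le fun s hs => ?_
      rw [← hgf t ht' s hs]
      exact h s hs t ht'
  rwa [abs_of_pos hb, mul_comm] at this

section Local

attribute [local instance] Matrix.linftyOpNormedRing Matrix.linftyOpNormedAlgebra

namespace HypSystem

variable {ν : ℕ} {S : HypSystem ν}

/-! ### Consistency of the flux and of the fluctuation with the frozen linear system -/

/-- Near a state `v` the numerical flux agrees with its linearization up to second order. -/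
theorem CoeffBound.norm_upwindFlux_sub_le {b K : ℝ} (hK : S.CoeffBound (S.states b) K) {n : Pt}
    (hn : ‖n‖ = 1) {v a w : State ν} (hv : v ∈ S.states b) (ha : a ∈ S.states b)
    (hw : w ∈ S.states b) {r : ℝ} (har : ‖a - v‖ ≤ r) (hwr : ‖w - v‖ ≤ r) :
    ‖S.upwindFlux a w n - (S.fluxN n v
      + (QuasiCons.jac S.Q v * dirMat S.Q S.F S.G n v).mulVec (a - v)
      + (QuasiCons.jac S.Q v * negPart (dirMat S.Q S.F S.G n v)).mulVec (w - a))‖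
      ≤ 3 * K * r ^ 2 := by
  have hr : 0 ≤ r := (norm_nonneg _).trans har
  have hK0 := hK.nonneg
  have h1 := (hK.jacDir n hn).norm_pathInt_sub_le (S.convex_states b) hK0 hv ha hv (r := r)
    (by simpa using hr) har
  have h2 := (hK.jacNeg n hn).norm_pathInt_sub_le (S.convex_states b) hK0 ha hw hv har hwr
  rw [hK.fluxN_sub_eq hn hv ha] at h1
  have h3 : ‖w - a‖ ≤ 2 * r := by
    have := norm_sub_le (w - v) (a - v)
    rw [sub_sub_sub_cancel_right] at this
    linarith
  have e : ∀ X Y : State ν, S.upwindFlux a w n - (S.fluxN n v + X + Y)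
      = (S.fluxN n a - S.fluxN n v - X)
        + (pathInt (fun v => QuasiCons.jac S.Q v * negPart (dirMat S.Q S.F S.G n v)) a w - Y) := by
    intro X Y
    rw [upwindFlux]; abel
  rw [e]
  refine (norm_add_le _ _).trans ((add_le_add h1 h2).trans ?_)
  have h4 : K * r * ‖a - v‖ ≤ K * r * r := by gcongr
  have h5 : K * r * ‖w - a‖ ≤ K * r * (2 * r) := by gcongr
  nlinarith

theorem CoeffBound.norm_fluct_sub_le {b K : ℝ} (hK : S.CoeffBound (S.states b) K) {n : Pt}
    (hn : ‖n‖ = 1) {v a w : State ν} (hv : v ∈ S.states b) (ha : a ∈ S.states b)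
    (hw : w ∈ S.states b) {r : ℝ} (har : ‖a - v‖ ≤ r) (hwr : ‖w - v‖ ≤ r) :
    ‖S.fluct n a w - (negPart (dirMat S.Q S.F S.G n v)).mulVec (w - a)‖ ≤ 2 * K * r ^ 2 := by
  have hr : 0 ≤ r := (norm_nonneg _).trans har
  have hK0 := hK.nonneg
  have h2 := (hK.neg n hn).norm_pathInt_sub_le (S.convex_states b) hK0 ha hw hv har hwr
  have h3 : ‖w - a‖ ≤ 2 * r := by
    have := norm_sub_le (w - v) (a - v)
    rw [sub_sub_sub_cancel_right] at this
    linarith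
  rw [S.fluct_eq_pathInt n hn ha.1 hw.1]
  refine h2.trans ?_
  have h5 : K * r * ‖w - a‖ ≤ K * r * (2 * r) := by gcongr
  nlinarith

end HypSystem

namespace DiscreteData

variable {ν : ℕ} {Ω : Set Pt} {M : Mesh Ω} {S : HypSystem ν} {D : DiscreteData ν M}

/-! ### The predictor on an edge -/

theorem exists_pred_lineMap (n : ℕ) (τ : Fin M.nsub) (p q : Pt) : ∃ c₀ c₁ c₂ : State ν,
    ∀ s t : ℝ, D.pred S n τ (AffineMap.lineMap p q s) t = c₀ + s • c₁ + t • c₂ := by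
  refine ⟨D.avg n τ + D.time n • ((S.A (D.avg n τ)).mulVec (D.Sx n τ)
      + (S.B (D.avg n τ)).mulVec (D.Sy n τ)) + (p 0 - M.ctr τ 0) • D.Sx n τ
      + (p 1 - M.ctr τ 1) • D.Sy n τ,
    (q 0 - p 0) • D.Sx n τ + (q 1 - p 1) • D.Sy n τ,
    -((S.A (D.avg n τ)).mulVec (D.Sx n τ) + (S.B (D.avg n τ)).mulVec (D.Sy n τ)),
    fun s t => ?_⟩
  simp only [pred, AffineMap.lineMap_apply, vsub_eq_sub, vadd_eq_add, PiLp.sub_apply,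
    PiLp.add_apply, PiLp.smul_apply, smul_eq_mul]
  module

theorem exists_outer_lineMap (n : ℕ) (τ : Fin M.nsub) (k : Fin 3) (p q : Pt) :
    ∃ c₀ c₁ c₂ : State ν,
      ∀ s t : ℝ, D.outer S n τ k (AffineMap.lineMap p q s) t = c₀ + s • c₁ + t • c₂ := by
  rcases hf : M.adj τ k with _ | f
  · refine ⟨D.ghost n τ k (p, 0), (D.ghost n τ k).linear (q - p, 0),
      (D.ghost n τ k).linear (0, 1), fun s t => ?_⟩
    have e : ((AffineMap.lineMap p q s : Pt), t)
        = (s • (q - p, (0 : ℝ)) + t • ((0 : Pt), (1 : ℝ))) +ᵥ (p, (0 : ℝ)) := by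
      simp [AffineMap.lineMap_apply]
    rw [outer_none hf, e, AffineMap.map_vadd, map_add, map_smul, map_smul, vadd_eq_add]
    abel
  · simp only [outer_some hf]
    exact exists_pred_lineMap n f.1 p q

/-! ### The defect on a subcell where all the states are close to the average -/

/-- All the states that enter the update on `τ` are within `c * h` of the average, have slopes at
most `c` and lie in a bounded set of admissible states; the time step is at most `c * h`, and the
geometry of `τ` is regular. -/
structure LocalBounds (S : HypSystem ν) (D : DiscreteData ν M) (b c σ : ℝ) (n : ℕ)
    (τ : Fin M.nsub) : Prop where
  avg_mem : D.avg n τ ∈ S.states b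
  slope_x : ‖D.Sx n τ‖ ≤ c
  slope_y : ‖D.Sy n τ‖ ≤ c
  pred_mem : ∀ x ∈ M.cell τ, ∀ t ∈ Set.Icc (D.time n) (D.time (n + 1)),
    D.pred S n τ x t ∈ S.states b
  pred_near : ∀ x ∈ M.cell τ, ∀ t ∈ Set.Icc (D.time n) (D.time (n + 1)),
    ‖D.pred S n τ x t - D.avg n τ‖ ≤ c * M.h τ
  outer_mem : ∀ k, ∀ x ∈ edge (M.vert τ) k, ∀ t ∈ Set.Icc (D.time n) (D.time (n + 1)),
    D.outer S n τ k x t ∈ S.states b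
  outer_near : ∀ k, ∀ x ∈ edge (M.vert τ) k, ∀ t ∈ Set.Icc (D.time n) (D.time (n + 1)),
    ‖D.outer S n τ k x t - D.avg n τ‖ ≤ c * M.h τ
  vh_mem : ∀ x ∈ M.cell τ, D.vh n τ x ∈ S.states b
  vh_succ_mem : ∀ x ∈ M.cell τ, D.vh (n + 1) τ x ∈ S.states b
  vh_near : ∀ x ∈ M.cell τ, ‖D.vh n τ x - D.avg n τ‖ ≤ c * M.h τ
  dt_pos : 0 < D.dt n
  dt_le : D.dt n ≤ c * M.h τ
  vol_ge : σ * M.h τ ^ 2 ≤ M.vol τ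
  h_le_one : M.h τ ≤ 1

/-- The linearized numerical flux at the midpoint of an edge and at the half time level. -/
noncomputable def midFlux (S : HypSystem ν) (D : DiscreteData ν M) (n : ℕ) (τ : Fin M.nsub)
    (k : Fin 3) : State ν :=
  S.fluxN (normal (M.vert τ) k) (D.avg n τ)
    + (jac S.Q (D.avg n τ) * dirMat S.Q S.F S.G (normal (M.vert τ) k) (D.avg n τ)).mulVec
      (D.pred S n τ (edgeMid (M.vert τ) k) (D.halfTime n) - D.avg n τ)
    + (jac S.Q (D.avg n τ) * negPart (dirMat S.Q S.F S.G (normal (M.vert τ) k) (D.avg n τ))).mulVec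
      (D.outer S n τ k (edgeMid (M.vert τ) k) (D.halfTime n)
        - D.pred S n τ (edgeMid (M.vert τ) k) (D.halfTime n))

/-- The fluctuation `D(v⁻, v⁺) · n` at the midpoint of an edge and at the half time level, with
its coefficient matrix frozen at the average. -/
noncomputable def midFluct (S : HypSystem ν) (D : DiscreteData ν M) (n : ℕ) (τ : Fin M.nsub)
    (k : Fin 3) : State ν :=
  (negPart (dirMat S.Q S.F S.G (normal (M.vert τ) k) (D.avg n τ))).mulVec
    (D.outer S n τ k (edgeMid (M.vert τ) k) (D.halfTime n)
      - D.pred S n τ (edgeMid (M.vert τ) k) (D.halfTime n))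

/-- The first order terms `A_V S_x + B_V S_y` at the average. -/
noncomputable def slopeTerm (S : HypSystem ν) (D : DiscreteData ν M) (n : ℕ) (τ : Fin M.nsub) :
    State ν :=
  (S.A (D.avg n τ)).mulVec (D.Sx n τ) + (S.B (D.avg n τ)).mulVec (D.Sy n τ)

/-- The flux balance of the linearized fluxes: constants drop out, the linear parts add up to
`|τ| (A_V S_x + B_V S_y)`, and the fluctuations remain. -/
theorem sum_midFlux (n : ℕ) (τ : Fin M.nsub) :
    ∑ k, edgeLen (M.vert τ) k • midFlux S D n τ k
      = (jac S.Q (D.avg n τ)).mulVec (M.vol τ • slopeTerm S D n τ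
        + ∑ k, edgeLen (M.vert τ) k • midFluct S D n τ k) := by
  obtain ⟨s0, s1⟩ := sum_edgeLen_mul_normal (M.ccw τ)
  obtain ⟨m00, m01, m10, m11⟩ := sum_edgeLen_mul_normal_mul (M.ccw τ)
  rw [← M.vol_eq] at m00 m11
  set J := jac S.Q (D.avg n τ) with hJ
  set v := D.avg n τ with hv
  set X := D.Sx n τ
  set Y := D.Sy n τ
  set ℓ := edgeLen (M.vert τ)
  set N := normal (M.vert τ)
  set c : ℝ := D.halfTime n - D.time n with hc
  set ξ : Fin 3 → ℝ := fun k => (edgeMid (M.vert τ) k - center (M.vert τ)) 0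
  set η : Fin 3 → ℝ := fun k => (edgeMid (M.vert τ) k - center (M.vert τ)) 1
  have hterm : ∀ k, ℓ k • midFlux S D n τ k
      = (ℓ k * N k 0) • (S.F (S.Q v) - c • J.mulVec ((S.A v).mulVec (slopeTerm S D n τ)))
        + (ℓ k * N k 1) • (S.G (S.Q v) - c • J.mulVec ((S.B v).mulVec (slopeTerm S D n τ)))
        + (ℓ k * N k 0 * ξ k) • J.mulVec ((S.A v).mulVec X)
        + (ℓ k * N k 0 * η k) • J.mulVec ((S.A v).mulVec Y)
        + (ℓ k * N k 1 * ξ k) • J.mulVec ((S.B v).mulVec X)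
        + (ℓ k * N k 1 * η k) • J.mulVec ((S.B v).mulVec Y)
        + ℓ k • J.mulVec (midFluct S D n τ k) := by
    intro k
    have hpred : D.pred S n τ (edgeMid (M.vert τ) k) (D.halfTime n) - D.avg n τ
        = -(c • slopeTerm S D n τ) + ξ k • X + η k • Y := by
      simp only [pred, slopeTerm, ξ, η, X, Y, hc, Mesh.ctr]
      abel
    rw [midFlux, hpred, ← Matrix.mulVec_mulVec, ← Matrix.mulVec_mulVec, ← midFluct,
      HypSystem.fluxN, dirMat]
    change ℓ k • (_ + J.mulVec ((N k 0 • S.A v + N k 1 • S.B v).mulVec _) + _) = _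
    simp only [Matrix.add_mulVec, Matrix.smul_mulVec, Matrix.mulVec_add, Matrix.mulVec_smul,
      Matrix.mulVec_neg]
    module
  rw [Finset.sum_congr rfl fun k _ => hterm k]
  simp only [Finset.sum_add_distrib, ← Finset.sum_smul]
  rw [s0, s1, m00, m01, m10, m11]
  simp only [slopeTerm, Matrix.mulVec_add, Matrix.mulVec_smul, Matrix.mulVec_sum, zero_smul,
    add_zero, zero_add, smul_add]
  rfl

theorem halfTime_mem {n : ℕ} (hdt : 0 < D.dt n) :
    D.halfTime n ∈ Set.Icc (D.time n) (D.time (n + 1)) := by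
  rw [time_succ, halfTime]
  exact ⟨by linarith, by linarith⟩

theorem edgeMid_mem (τ : Fin M.nsub) (k : Fin 3) :
    edgeMid (M.vert τ) k ∈ edge (M.vert τ) k := by
  rw [edgeMid_eq_lineMap]
  exact lineMap_mem_edge _ _ ⟨by norm_num, by norm_num⟩

variable {b c σ K : ℝ} {n : ℕ} {τ : Fin M.nsub}

/-- The time averaged numerical flux is the linearized flux up to a second order error. -/
theorem LocalBounds.norm_faceFlux_sub_le (H : LocalBounds S D b c σ n τ)
    (hK : S.CoeffBound (S.states b) K) (k : Fin 3) :
    ‖D.faceFlux S S.upwindFlux n τ k - edgeLen (M.vert τ) k • midFlux S D n τ k‖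
      ≤ edgeLen (M.vert τ) k * (3 * K * (c * M.h τ) ^ 2) := by
  have hN := norm_normal (M.ccw τ) k
  have hdt := H.dt_pos
  obtain ⟨a₀, a₁, a₂, ha⟩ := exists_pred_lineMap (S := S) (D := D) n τ
    (M.vert τ (k + 1)) (M.vert τ (k + 2))
  obtain ⟨w₀, w₁, w₂, hw⟩ := exists_outer_lineMap (S := S) (D := D) n τ k
    (M.vert τ (k + 1)) (M.vert τ (k + 2))
  have hmem : ∀ s ∈ Set.Icc (0 : ℝ) 1, ∀ t ∈ Set.Icc (D.time n) (D.time (n + 1)),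
      (a₀ + s • a₁ + t • a₂ ∈ S.states b ∧ w₀ + s • w₁ + t • w₂ ∈ S.states b) ∧
      ‖a₀ + s • a₁ + t • a₂ - D.avg n τ‖ ≤ c * M.h τ ∧
      ‖w₀ + s • w₁ + t • w₂ - D.avg n τ‖ ≤ c * M.h τ := by
    intro s hs t ht
    have hx := lineMap_mem_edge (M.vert τ) k hs
    have hx' := M.edge_subset_cell τ k hx
    rw [← ha, ← hw]
    exact ⟨⟨H.pred_mem _ hx' t ht, H.outer_mem k _ hx t ht⟩, H.pred_near _ hx' t ht,
      H.outer_near k _ hx t ht⟩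
  set JD := jac S.Q (D.avg n τ) * dirMat S.Q S.F S.G (normal (M.vert τ) k) (D.avg n τ) with hJD
  set JN := jac S.Q (D.avg n τ) * negPart (dirMat S.Q S.F S.G (normal (M.vert τ) k) (D.avg n τ))
    with hJN
  set Φ := S.fluxN (normal (M.vert τ) k) (D.avg n τ) with hΦ
  have hcont : ContinuousOn (fun y : ℝ × ℝ => S.upwindFlux (a₀ + y.1 • a₁ + y.2 • a₂)
      (w₀ + y.1 • w₁ + y.2 • w₂) (normal (M.vert τ) k))
      (Set.Icc 0 1 ×ˢ Set.Icc (D.time n) (D.time (n + 1))) := by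
    obtain ⟨L, hL⟩ := S.isNumericalFlux_upwindFlux.lipschitz b
    have hlip : LipschitzOnWith (Real.toNNReal (|L| * 2))
        (fun z : State ν × State ν => S.upwindFlux z.1 z.2 (normal (M.vert τ) k))
        (S.states b ×ˢ S.states b) := by
      refine LipschitzOnWith.of_dist_le_mul fun z hz y hy => ?_
      rw [Real.coe_toNNReal _ (by positivity), dist_eq_norm, dist_eq_norm]
      refine (hL _ hz.1.1 _ hz.2.1 _ hy.1.1 _ hy.2.1 (S.mem_states.1 hz.1).2
        (S.mem_states.1 hz.2).2 (S.mem_states.1 hy.1).2 (S.mem_states.1 hy.2).2 _ hN).trans ?_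
      have h1 : ‖z.1 - y.1‖ ≤ ‖z - y‖ := norm_fst_le (z - y)
      have h2 : ‖z.2 - y.2‖ ≤ ‖z - y‖ := norm_snd_le (z - y)
      calc L * (‖z.1 - y.1‖ + ‖z.2 - y.2‖) ≤ |L| * (‖z.1 - y.1‖ + ‖z.2 - y.2‖) :=
            mul_le_mul_of_nonneg_right (le_abs_self L) (by positivity)
        _ ≤ |L| * (‖z - y‖ + ‖z - y‖) := by gcongr
        _ = _ := by ring
    refine hlip.continuousOn.comp (f := fun y : ℝ × ℝ =>
      (a₀ + y.1 • a₁ + y.2 • a₂, w₀ + y.1 • w₁ + y.2 • w₂)) (by fun_prop) fun y hy => ?_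
    exact (hmem y.1 hy.1 y.2 hy.2).1
  have hmean := norm_mean_sub_le (a := D.time n) (b := D.time (n + 1))
    (ε := 3 * K * (c * M.h τ) ^ 2) (by rw [time_succ]; linarith) hcont
    (c₀ := Φ + JD.mulVec (a₀ - D.avg n τ) + JN.mulVec (w₀ - a₀))
    (c₁ := JD.mulVec a₁ + JN.mulVec (w₁ - a₁)) (c₂ := JD.mulVec a₂ + JN.mulVec (w₂ - a₂))
    (fun s hs t ht => by
      obtain ⟨⟨h1, h2⟩, h3, h4⟩ := hmem s hs t ht
      have := hK.norm_upwindFlux_sub_le hN H.avg_mem h1 h2 h3 h4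
      have e : Φ + JD.mulVec (a₀ - D.avg n τ) + JN.mulVec (w₀ - a₀)
          + s • (JD.mulVec a₁ + JN.mulVec (w₁ - a₁)) + t • (JD.mulVec a₂ + JN.mulVec (w₂ - a₂))
          = Φ + JD.mulVec (a₀ + s • a₁ + t • a₂ - D.avg n τ)
            + JN.mulVec (w₀ + s • w₁ + t • w₂ - (a₀ + s • a₁ + t • a₂)) := by
        simp only [Matrix.mulVec_add, Matrix.mulVec_sub, Matrix.mulVec_smul]
        module
      rw [e]
      exact this)
  have hmid : midFlux S D n τ k = Φ + JD.mulVec (a₀ - D.avg n τ) + JN.mulVec (w₀ - a₀)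
      + (1 / 2 : ℝ) • (JD.mulVec a₁ + JN.mulVec (w₁ - a₁))
      + ((D.time n + D.time (n + 1)) / 2) • (JD.mulVec a₂ + JN.mulVec (w₂ - a₂)) := by
    have ht : D.halfTime n = (D.time n + D.time (n + 1)) / 2 := by
      rw [time_succ, halfTime]; ring
    rw [midFlux, edgeMid_eq_lineMap, ha, hw, ht]
    simp only [← hJD, ← hJN, ← hΦ, Matrix.mulVec_add, Matrix.mulVec_sub, Matrix.mulVec_smul]
    module
  have hface : D.faceFlux S S.upwindFlux n τ k = edgeLen (M.vert τ) k •
      ((D.time (n + 1) - D.time n)⁻¹ • ∫ t in (D.time n)..(D.time (n + 1)), ∫ s in (0 : ℝ)..1,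
        S.upwindFlux (a₀ + s • a₁ + t • a₂) (w₀ + s • w₁ + t • w₂) (normal (M.vert τ) k)) := by
    rw [faceFlux, intervalIntegral.integral_smul, smul_comm, time_succ, add_sub_cancel_left]
    simp only [ha, hw]
  rw [hface, hmid, ← smul_sub, norm_smul, Real.norm_of_nonneg (edgeLen_nonneg _ _)]
  exact mul_le_mul_of_nonneg_left hmean (edgeLen_nonneg _ _)

theorem LocalBounds.c_nonneg (H : LocalBounds S D b c σ n τ) : 0 ≤ c :=
  (norm_nonneg _).trans H.slope_x

theorem LocalBounds.edgeLen_div_vol_le (H : LocalBounds S D b c σ n τ) (hσ : 0 < σ) (k : Fin 3) :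
    (M.vol τ)⁻¹ * edgeLen (M.vert τ) k * M.h τ ≤ σ⁻¹ := by
  have h1 := M.edgeLen_le_h τ k
  have h2 := H.vol_ge
  have hv := M.vol_pos τ
  have hh := M.h_pos τ
  rw [mul_assoc, inv_mul_le_iff₀ hv, ← div_eq_mul_inv, le_div_iff₀ hσ]
  nlinarith [mul_le_mul_of_nonneg_right (mul_le_mul_of_nonneg_right h1 hh.le) hσ.le]

/-- The scaled evolution operator is the frozen one up to a first order error. -/
theorem LocalBounds.norm_evol_add_le (H : LocalBounds S D b c σ n τ) (hσ : 0 < σ)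
    (hK : S.CoeffBound (S.states b) K) :
    ‖(M.vol τ)⁻¹ • D.evol S n τ + (slopeTerm S D n τ
      + (M.vol τ)⁻¹ • ∑ k, edgeLen (M.vert τ) k • midFluct S D n τ k)‖
      ≤ (2 + 6 * σ⁻¹) * K * c ^ 2 * M.h τ := by
  have hv := M.vol_pos τ
  have hh := M.h_pos τ
  have hc := H.c_nonneg
  have hK0 := hK.nonneg
  have hm := halfTime_mem H.dt_pos
  set P := D.pred S n τ (M.ctr τ) (D.halfTime n) with hP
  have hPm : P ∈ S.states b := H.pred_mem _ (M.ctr_mem τ) _ hm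
  have hPn : ‖P - D.avg n τ‖ ≤ c * M.h τ := H.pred_near _ (M.ctr_mem τ) _ hm
  set fl : Fin 3 → State ν := fun k => S.fluct (normal (M.vert τ) k)
        (D.pred S n τ (edgeMid (M.vert τ) k) (D.halfTime n))
        (D.outer S n τ k (edgeMid (M.vert τ) k) (D.halfTime n)) with hfl
  have e : (M.vol τ)⁻¹ • D.evol S n τ + (slopeTerm S D n τ
      + (M.vol τ)⁻¹ • ∑ k, edgeLen (M.vert τ) k • midFluct S D n τ k)
      = -((S.A P - S.A (D.avg n τ)).mulVec (D.Sx n τ)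
          + (S.B P - S.B (D.avg n τ)).mulVec (D.Sy n τ))
        - ∑ k, ((M.vol τ)⁻¹ * edgeLen (M.vert τ) k) • (fl k - midFluct S D n τ k) := by
    rw [evol, smul_sub, smul_neg, inv_smul_smul₀ hv.ne']
    simp only [Matrix.sub_mulVec, smul_sub, Finset.sum_sub_distrib, Finset.smul_sum, mul_smul,
      slopeTerm, ← hP, hfl]
    abel
  have hA : ‖(S.A P - S.A (D.avg n τ)).mulVec (D.Sx n τ)‖ ≤ K * (c * M.h τ) * c := by
    refine (mulVec_norm_le _ _).trans (mul_le_mul ?_ H.slope_x (norm_nonneg _) (by positivity))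
    exact (hK.matA.lip _ hPm _ H.avg_mem).trans (mul_le_mul_of_nonneg_left hPn hK0)
  have hB : ‖(S.B P - S.B (D.avg n τ)).mulVec (D.Sy n τ)‖ ≤ K * (c * M.h τ) * c := by
    refine (mulVec_norm_le _ _).trans (mul_le_mul ?_ H.slope_y (norm_nonneg _) (by positivity))
    exact (hK.matB.lip _ hPm _ H.avg_mem).trans (mul_le_mul_of_nonneg_left hPn hK0)
  have hsum : ‖∑ k, ((M.vol τ)⁻¹ * edgeLen (M.vert τ) k) • (fl k - midFluct S D n τ k)‖
      ≤ ∑ _k : Fin 3, σ⁻¹ * (2 * K * c ^ 2 * M.h τ) := by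
    refine norm_sum_le_of_le _ fun k _ => ?_
    have hx := edgeMid_mem τ k
    have h1 := hK.norm_fluct_sub_le (norm_normal (M.ccw τ) k) H.avg_mem
      (H.pred_mem _ (M.edge_subset_cell τ k hx) _ hm) (H.outer_mem k _ hx _ hm)
      (H.pred_near _ (M.edge_subset_cell τ k hx) _ hm) (H.outer_near k _ hx _ hm)
    have h0 := edgeLen_nonneg (M.vert τ) k
    rw [norm_smul, Real.norm_of_nonneg (by positivity)]
    calc _ ≤ (M.vol τ)⁻¹ * edgeLen (M.vert τ) k * (2 * K * (c * M.h τ) ^ 2) :=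
          mul_le_mul_of_nonneg_left h1 (by positivity)
      _ = (M.vol τ)⁻¹ * edgeLen (M.vert τ) k * M.h τ * (2 * K * c ^ 2 * M.h τ) := by ring
      _ ≤ _ := mul_le_mul_of_nonneg_right (H.edgeLen_div_vol_le hσ k) (by positivity)
  rw [e]
  refine (norm_sub_le _ _).trans ?_
  rw [norm_neg]
  refine (add_le_add ((norm_add_le _ _).trans (add_le_add hA hB)) hsum).trans (le_of_eq ?_)
  simp
  ring

/-- The scaled evolution operator is bounded. -/
theorem LocalBounds.norm_evol_le (H : LocalBounds S D b c σ n τ) (hσ : 0 < σ)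
    (hK : S.CoeffBound (S.states b) K) :
    ‖(M.vol τ)⁻¹ • D.evol S n τ‖ ≤ (2 + 6 * σ⁻¹) * K * c * (c + 1) := by
  have hv := M.vol_pos τ
  have hh := M.h_pos τ
  have hc := H.c_nonneg
  have hK0 := hK.nonneg
  have hm := halfTime_mem H.dt_pos
  have h1 := H.norm_evol_add_le hσ hK
  have h2 : ‖slopeTerm S D n τ‖ ≤ 2 * (K * c) := by
    refine (norm_add_le _ _).trans ?_
    have hA := (mulVec_norm_le (S.A (D.avg n τ)) (D.Sx n τ)).trans
      (mul_le_mul (hK.matA.bdd _ H.avg_mem) H.slope_x (norm_nonneg _) hK0)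
    have hB := (mulVec_norm_le (S.B (D.avg n τ)) (D.Sy n τ)).trans
      (mul_le_mul (hK.matB.bdd _ H.avg_mem) H.slope_y (norm_nonneg _) hK0)
    linarith
  have h3 : ‖(M.vol τ)⁻¹ • ∑ k, edgeLen (M.vert τ) k • midFluct S D n τ k‖
      ≤ ∑ _k : Fin 3, σ⁻¹ * (2 * (K * c)) := by
    rw [Finset.smul_sum]
    refine norm_sum_le_of_le _ fun k _ => ?_
    have hx := edgeMid_mem τ k
    have h0 := edgeLen_nonneg (M.vert τ) k
    have hd : ‖D.outer S n τ k (edgeMid (M.vert τ) k) (D.halfTime n)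
        - D.pred S n τ (edgeMid (M.vert τ) k) (D.halfTime n)‖ ≤ 2 * (c * M.h τ) := by
      have := norm_sub_le (D.outer S n τ k (edgeMid (M.vert τ) k) (D.halfTime n) - D.avg n τ)
        (D.pred S n τ (edgeMid (M.vert τ) k) (D.halfTime n) - D.avg n τ)
      rw [sub_sub_sub_cancel_right] at this
      linarith [H.pred_near _ (M.edge_subset_cell τ k hx) _ hm, H.outer_near k _ hx _ hm]
    have hf : ‖midFluct S D n τ k‖ ≤ K * (2 * (c * M.h τ)) :=
      (mulVec_norm_le _ _).trans (mul_le_mul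
        ((hK.neg _ (norm_normal (M.ccw τ) k)).bdd _ H.avg_mem) hd (norm_nonneg _) hK0)
    rw [smul_smul, norm_smul, Real.norm_of_nonneg (by positivity)]
    calc _ ≤ (M.vol τ)⁻¹ * edgeLen (M.vert τ) k * (K * (2 * (c * M.h τ))) :=
          mul_le_mul_of_nonneg_left hf (by positivity)
      _ = (M.vol τ)⁻¹ * edgeLen (M.vert τ) k * M.h τ * (2 * (K * c)) := by ring
      _ ≤ _ := mul_le_mul_of_nonneg_right (H.edgeLen_div_vol_le hσ k) (by positivity)
  have h4 : (2 + 6 * σ⁻¹) * K * c ^ 2 * M.h τ ≤ (2 + 6 * σ⁻¹) * K * c ^ 2 :=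
    mul_le_of_le_one_right (by positivity) H.h_le_one
  have h5 : ∑ _k : Fin 3, σ⁻¹ * (2 * (K * c)) = 6 * σ⁻¹ * (K * c) := by simp; ring
  rw [h5] at h3
  have h6 := norm_add_le (slopeTerm S D n τ)
    ((M.vol τ)⁻¹ • ∑ k, edgeLen (M.vert τ) k • midFluct S D n τ k)
  have h7 := norm_sub_le ((M.vol τ)⁻¹ • D.evol S n τ + (slopeTerm S D n τ
      + (M.vol τ)⁻¹ • ∑ k, edgeLen (M.vert τ) k • midFluct S D n τ k)) (slopeTerm S D n τ
      + (M.vol τ)⁻¹ • ∑ k, edgeLen (M.vert τ) k • midFluct S D n τ k)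
  rw [add_sub_cancel_right] at h7
  nlinarith

end DiscreteData

end Local

section Defect

attribute [local instance] Matrix.linftyOpNormedRing Matrix.linftyOpNormedAlgebra

namespace DiscreteData

variable {ν : ℕ} {Ω : Set Pt} {M : Mesh Ω} {S : HypSystem ν} {D : DiscreteData ν M}
  {b c σ K : ℝ} {n : ℕ} {τ : Fin M.nsub}

theorem IsScheme.integrableOn_Q (hD : D.IsScheme S) (hn : n ≤ D.nt) (τ : Fin M.nsub) :
    IntegrableOn (fun x => S.Q (D.vh n τ x)) (M.cell τ) := by
  refine ContinuousOn.integrableOn_compact (isCompact_tri _) ?_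
  have hQ : ContinuousOn S.Q S.adm := fun v hv =>
    (S.differentiable_Q v hv).continuousAt.continuousWithinAt
  exact hQ.comp (hD.smooth n hn τ).continuous.continuousOn fun x hx => hD.vh_adm n hn τ x hx

/-- The difference quotient of the conserved average is the linearized one up to `O(h)`: the states
before and after the update are both within `O(h)` of the average. -/
theorem LocalBounds.norm_increment_sub_le (H : LocalBounds S D b c σ n τ)
    (hK : S.CoeffBound (S.states b) K) (hD : D.IsScheme S) (hn : n < D.nt) {W : ℝ}
    (hW : ‖(M.vol τ)⁻¹ • D.evol S n τ‖ ≤ W) :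
    ‖(M.vol τ)⁻¹ • (D.dt n)⁻¹ • ((∫ x in M.cell τ, S.Q (D.vh (n + 1) τ x))
        - ∫ x in M.cell τ, S.Q (D.vh n τ x))
      - (jac S.Q (D.avg n τ)).mulVec ((M.vol τ)⁻¹ • D.evol S n τ)‖
      ≤ K * (c * (1 + W)) * W * M.h τ := by
  have hv := M.vol_pos τ
  have hh := M.h_pos τ
  have hc := H.c_nonneg
  have hK0 := hK.nonneg
  have hdt := H.dt_pos
  set w := (M.vol τ)⁻¹ • D.evol S n τ with hw
  have hW0 : 0 ≤ W := (norm_nonneg _).trans hW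
  set J := jac S.Q (D.avg n τ)
  have hpt : ∀ x ∈ M.cell τ,
      ‖S.Q (D.vh (n + 1) τ x) - S.Q (D.vh n τ x) - D.dt n • J.mulVec w‖
        ≤ K * (c * (1 + W) * M.h τ) * (D.dt n * W) := by
    intro x hx
    have hinc : D.vh (n + 1) τ x - D.vh n τ x = D.dt n • w := by
      rw [hD.update n hn τ x hx, add_sub_cancel_left, hw, smul_smul, div_eq_mul_inv]
    have hincn : ‖D.dt n • w‖ ≤ D.dt n * W := by
      rw [norm_smul, Real.norm_of_nonneg hdt.le]
      exact mul_le_mul_of_nonneg_left hW hdt.le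
    have hdtW : D.dt n * W ≤ c * M.h τ * W := mul_le_mul_of_nonneg_right H.dt_le hW0
    have h0 := H.vh_near x hx
    have hchW : 0 ≤ c * M.h τ * W := by positivity
    have h1 : ‖D.vh (n + 1) τ x - D.avg n τ‖ ≤ c * (1 + W) * M.h τ := by
      have e : D.vh (n + 1) τ x - D.avg n τ
          = (D.vh n τ x - D.avg n τ) + (D.vh (n + 1) τ x - D.vh n τ x) := by abel
      rw [e, hinc]
      refine (norm_add_le _ _).trans ?_
      linarith
    have h2 := hK.jac.norm_pathInt_sub_le (S.convex_states b) hK0 (H.vh_mem x hx)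
      (H.vh_succ_mem x hx) H.avg_mem (r := c * (1 + W) * M.h τ) (by linarith) h1
    rw [hK.Q_sub_eq (H.vh_mem x hx) (H.vh_succ_mem x hx), hinc, Matrix.mulVec_smul] at h2
    exact h2.trans (mul_le_mul_of_nonneg_left hincn (by positivity))
  have hint : (∫ x in M.cell τ, S.Q (D.vh (n + 1) τ x)) - (∫ x in M.cell τ, S.Q (D.vh n τ x))
      - M.vol τ • D.dt n • J.mulVec w
      = ∫ x in M.cell τ, (S.Q (D.vh (n + 1) τ x) - S.Q (D.vh n τ x) - D.dt n • J.mulVec w) := by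
    have i1 : IntegrableOn (fun x => S.Q (D.vh (n + 1) τ x)) (M.cell τ) := hD.integrableOn_Q hn τ
    have i0 := hD.integrableOn_Q hn.le τ
    have i2 : IntegrableOn (fun x => S.Q (D.vh (n + 1) τ x) - S.Q (D.vh n τ x)) (M.cell τ) :=
      i1.sub i0
    rw [integral_sub i2 (integrableOn_const (M.vol_lt_top τ).ne), integral_sub i1 i0,
      setIntegral_const]
    rfl
  have hbound := norm_setIntegral_le_of_norm_le_const (M.vol_lt_top τ) hpt
  rw [← hint] at hbound
  have e : (M.vol τ)⁻¹ • (D.dt n)⁻¹ • ((∫ x in M.cell τ, S.Q (D.vh (n + 1) τ x))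
        - ∫ x in M.cell τ, S.Q (D.vh n τ x)) - J.mulVec w
      = (M.vol τ * D.dt n)⁻¹ • ((∫ x in M.cell τ, S.Q (D.vh (n + 1) τ x))
        - (∫ x in M.cell τ, S.Q (D.vh n τ x)) - M.vol τ • D.dt n • J.mulVec w) := by
    rw [smul_sub _ _ (M.vol τ • _), smul_smul (M.vol τ), inv_smul_smul₀ (by positivity), mul_inv,
      mul_smul]
  rw [e, norm_smul, norm_inv, Real.norm_of_nonneg (by positivity), inv_mul_le_iff₀ (by positivity)]
  refine hbound.trans (le_of_eq ?_)
  change _ * M.vol τ = _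
  ring

/-- The subcell defect is of first order: increment and fluxes cancel after linearization. -/
theorem LocalBounds.norm_defectSub_le (H : LocalBounds S D b c σ n τ) (hσ : 0 < σ)
    (hK : S.CoeffBound (S.states b) K) (hD : D.IsScheme S) (hn : n < D.nt) {W : ℝ}
    (hW : W = (2 + 6 * σ⁻¹) * K * c * (c + 1)) :
    ‖D.defectSub S S.upwindFlux n τ‖ ≤ (K * (c * (1 + W)) * W + 9 * σ⁻¹ * K * c ^ 2
      + K * ((2 + 6 * σ⁻¹) * K * c ^ 2)) * M.h τ := by
  have hv := M.vol_pos τ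
  have hh := M.h_pos τ
  have hc := H.c_nonneg
  have hK0 := hK.nonneg
  have h1 := H.norm_increment_sub_le hK hD hn ((H.norm_evol_le hσ hK).trans_eq hW.symm)
  have h2 := H.norm_evol_add_le hσ hK
  set J := jac S.Q (D.avg n τ)
  set w := (M.vol τ)⁻¹ • D.evol S n τ
  set I := (∫ x in M.cell τ, S.Q (D.vh (n + 1) τ x)) - ∫ x in M.cell τ, S.Q (D.vh n τ x)
  have h3 : ‖(M.vol τ)⁻¹ • ∑ k, (D.faceFlux S S.upwindFlux n τ k
      - edgeLen (M.vert τ) k • midFlux S D n τ k)‖ ≤ ∑ _k : Fin 3, σ⁻¹ * (3 * K * c ^ 2 * M.h τ) := by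
    rw [Finset.smul_sum]
    refine norm_sum_le_of_le _ fun k _ => ?_
    rw [norm_smul, norm_inv, Real.norm_of_nonneg hv.le]
    calc _ ≤ (M.vol τ)⁻¹ * (edgeLen (M.vert τ) k * (3 * K * (c * M.h τ) ^ 2)) :=
          mul_le_mul_of_nonneg_left (H.norm_faceFlux_sub_le hK k) (by positivity)
      _ = (M.vol τ)⁻¹ * edgeLen (M.vert τ) k * M.h τ * (3 * K * c ^ 2 * M.h τ) := by ring
      _ ≤ _ := mul_le_mul_of_nonneg_right (H.edgeLen_div_vol_le hσ k) (by positivity)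
  have e : D.defectSub S S.upwindFlux n τ
      = ((M.vol τ)⁻¹ • (D.dt n)⁻¹ • I - J.mulVec w)
        + (M.vol τ)⁻¹ • ∑ k, (D.faceFlux S S.upwindFlux n τ k
          - edgeLen (M.vert τ) k • midFlux S D n τ k)
        + J.mulVec (w + (slopeTerm S D n τ
          + (M.vol τ)⁻¹ • ∑ k, edgeLen (M.vert τ) k • midFluct S D n τ k)) := by
    have hd : D.defectSub S S.upwindFlux n τ
        = (M.vol τ)⁻¹ • (D.dt n)⁻¹ • I
          + (M.vol τ)⁻¹ • ∑ k, D.faceFlux S S.upwindFlux n τ k := by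
      rw [defectSub, hD.setIntegral_Q_succ hn]
    rw [hd, Finset.sum_sub_distrib, sum_midFlux, smul_sub (M.vol τ)⁻¹ (Finset.sum _ _),
      ← Matrix.mulVec_smul, smul_add (M.vol τ)⁻¹, inv_smul_smul₀ hv.ne', Matrix.mulVec_add J w]
    abel
  have h4 := (mulVec_norm_le J (w + (slopeTerm S D n τ
    + (M.vol τ)⁻¹ • ∑ k, edgeLen (M.vert τ) k • midFluct S D n τ k))).trans
    (mul_le_mul (hK.jac.bdd _ H.avg_mem) h2 (norm_nonneg _) hK0)
  rw [e]
  refine (norm_add_le _ _).trans ((add_le_add ((norm_add_le _ _).trans (add_le_add h1 h3))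
    h4).trans (le_of_eq ?_))
  simp
  ring

/-! ### Local bounds from smoothness -/

theorem IsScheme.avg_adm (hD : D.IsScheme S) (hn : n < D.nt) (τ : Fin M.nsub) :
    D.avg n τ ∈ S.adm := by
  have h := hD.pred_adm n hn τ (M.ctr τ) (M.ctr_mem τ) (D.time n)
    ⟨le_rfl, by rw [time_succ]; linarith [hD.dt_pos n hn]⟩
  simpa [pred] using h

/-- Averages stay in the balls that contain the values. -/
theorem IsScheme.norm_avg_sub_le (hD : D.IsScheme S) (hn : n ≤ D.nt) (τ : Fin M.nsub)
    {v : State ν} {r : ℝ} (h : ∀ x ∈ M.cell τ, ‖D.vh n τ x - v‖ ≤ r) : ‖D.avg n τ - v‖ ≤ r := by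
  have := (convex_closedBall v r).set_average_mem Metric.isClosed_closedBall
    (μ := volume) (t := M.cell τ) (f := D.vh n τ)
    (fun h0 => (M.vol_pos τ).ne' (by rw [Mesh.vol, area, h0, ENNReal.toReal_zero]))
    (M.vol_lt_top τ).ne
    ((ae_restrict_iff' (M.measurableSet_cell τ)).2 (ae_of_all _ fun x hx => by
      simpa [dist_eq_norm] using h x hx))
    ((hD.smooth n hn τ).continuous.continuousOn.integrableOn_compact (isCompact_tri _))
  rwa [Metric.mem_closedBall, dist_eq_norm] at this

variable {C C' : ℝ}

theorem SmoothAt.norm_vh_sub_le (h : D.SmoothAt C C' n τ) {τ' : Fin M.nsub} {x : Pt}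
    (hx : x ∈ M.cell τ) (hx' : x ∈ M.cell τ') :
    ‖D.vh n τ' x - D.vh n τ (M.ctr τ)‖ ≤ C * M.h τ := by
  obtain ⟨r, hr, hb⟩ := h.ball
  have hsub : M.cell τ ⊆ Metric.ball (M.ctr τ) r := by
    refine convexHull_min ?_ (convex_ball _ _)
    rintro _ ⟨k, rfl⟩
    exact hr (vertex_mem_frontier (M.ccw τ) k)
  exact (le_max_left _ _).trans (hb τ' x ⟨hsub hx, hx'⟩)

theorem SmoothAt.C_nonneg (h : D.SmoothAt C C' n τ) : 0 ≤ C := by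
  have h1 := (norm_nonneg _).trans (h.norm_vh_sub_le (M.ctr_mem τ) (M.ctr_mem τ))
  exact nonneg_of_mul_nonneg_left h1 (M.h_pos τ)

theorem SmoothAt.norm_avg_sub_le (h : D.SmoothAt C C' n τ) (hD : D.IsScheme S) (hn : n ≤ D.nt) :
    ‖D.avg n τ - D.vh n τ (M.ctr τ)‖ ≤ C * M.h τ :=
  hD.norm_avg_sub_le hn τ fun _ hx => h.norm_vh_sub_le hx hx

/-- Averages of subcells with a common vertex are close: compare both with a value at the
vertex. -/
theorem SmoothAt.norm_avg_sub_avg_le {τ' : Fin M.nsub} (h : D.SmoothAt C C' n τ)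
    (h' : D.SmoothAt C C' n τ') (hs : M.ShareVertex τ τ') (hD : D.IsScheme S) (hn : n ≤ D.nt) :
    ‖D.avg n τ' - D.avg n τ‖ ≤ 2 * C * (M.h τ + M.h τ') := by
  obtain ⟨k, l, hkl⟩ := hs
  have hp : M.vert τ k ∈ M.cell τ := vertex_mem_tri _ _
  have hp' : M.vert τ k ∈ M.cell τ' := hkl ▸ vertex_mem_tri _ _
  have e1 := h.norm_avg_sub_le hD hn
  have e2 := h'.norm_avg_sub_le hD hn
  have e3 := h.norm_vh_sub_le hp hp'
  have e4 := h'.norm_vh_sub_le hp' hp'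
  have e : D.avg n τ' - D.avg n τ = (D.avg n τ' - D.vh n τ' (M.ctr τ'))
      - (D.vh n τ' (M.vert τ k) - D.vh n τ' (M.ctr τ'))
      + (D.vh n τ' (M.vert τ k) - D.vh n τ (M.ctr τ)) - (D.avg n τ - D.vh n τ (M.ctr τ)) := by
    abel
  rw [e]
  refine (norm_sub_le _ _).trans ((add_le_add ((norm_add_le _ _).trans (add_le_add
    (norm_sub_le _ _) le_rfl)) le_rfl).trans ?_)
  linarith

theorem norm_ctr_sub_le_of_shareVertex {τ τ' : Fin M.nsub}
    (hs : M.ShareVertex τ τ') : ‖M.ctr τ' - M.ctr τ‖ ≤ M.h τ + M.h τ' := by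
  obtain ⟨k, l, hkl⟩ := hs
  have h1 := M.norm_sub_le_h (vertex_mem_tri (M.vert τ) k) (M.ctr_mem τ)
  have h2 := M.norm_sub_le_h (M.ctr_mem τ') (hkl ▸ vertex_mem_tri (M.vert τ') l)
  have := norm_add_le (M.ctr τ' - M.vert τ k) (M.vert τ k - M.ctr τ)
  rw [sub_add_sub_cancel] at this
  linarith

/-- The gradient of the interpolant of small increments on a regular stencil, by Cramer's rule. -/
theorem exists_gradient {d₁ d₂ : Pt} {δ₁ δ₂ H g σ : ℝ} (hσ : 0 < σ) (hH : 0 < H)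
    (hd₁ : ‖d₁‖ ≤ H) (hd₂ : ‖d₂‖ ≤ H) (hδ₁ : |δ₁| ≤ g * H) (hδ₂ : |δ₂| ≤ g * H)
    (hdet : σ * H ^ 2 ≤ |cross d₁ d₂|) :
    ∃ gx gy : ℝ, gx * d₁ 0 + gy * d₁ 1 = δ₁ ∧ gx * d₂ 0 + gy * d₂ 1 = δ₂ ∧
      |gx| ≤ 2 * g / σ ∧ |gy| ≤ 2 * g / σ := by
  have hpos : 0 < |cross d₁ d₂| := lt_of_lt_of_le (by positivity) hdet
  have hne : cross d₁ d₂ ≠ 0 := abs_pos.1 hpos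
  have hg : 0 ≤ g := by
    have := (abs_nonneg _).trans hδ₁
    exact nonneg_of_mul_nonneg_left this hH
  have aux : ∀ i, |δ₁ * d₂ i - δ₂ * d₁ i| / |cross d₁ d₂| ≤ 2 * g / σ := by
    intro i
    have h1 : |δ₁ * d₂ i - δ₂ * d₁ i| ≤ 2 * g * H ^ 2 := by
      refine (abs_sub _ _).trans ?_
      rw [abs_mul, abs_mul]
      have e1 := mul_le_mul hδ₁ ((HypSystem.abs_coord_le d₂ i).trans hd₂) (abs_nonneg _)
        (by positivity)
      have e2 := mul_le_mul hδ₂ ((HypSystem.abs_coord_le d₁ i).trans hd₁) (abs_nonneg _)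
        (by positivity)
      nlinarith
    rw [div_le_div_iff₀ hpos hσ]
    calc |δ₁ * d₂ i - δ₂ * d₁ i| * σ ≤ 2 * g * H ^ 2 * σ := by gcongr
      _ = 2 * g * (σ * H ^ 2) := by ring
      _ ≤ _ := by gcongr
  refine ⟨(δ₁ * d₂ 1 - δ₂ * d₁ 1) / cross d₁ d₂, -((δ₁ * d₂ 0 - δ₂ * d₁ 0) / cross d₁ d₂), ?_, ?_,
    by rw [abs_div]; exact aux 1, by rw [abs_neg, abs_div]; exact aux 0⟩
  · field_simp
    rw [cross]; ring
  · field_simp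
    rw [cross]; ring

/-- The ENO slopes are bounded, since the shape regular stencil competes in the minimization. -/
theorem norm_slope_le (hσ : 0 < σ) (hM : M.ShapeRegular σ) (hD : D.IsScheme S) (hn : n < D.nt)
    (h : ∀ τ', M.ShareVertex τ τ' → D.SmoothAt C C' n τ') :
    ‖D.Sx n τ‖ ≤ 8 * |C| / σ ∧ ‖D.Sy n τ‖ ≤ 8 * |C| / σ := by
  obtain ⟨s, hs, hdet⟩ := hM.stencil τ
  obtain ⟨hs1, hs2⟩ : M.ShareVertex τ s.1 ∧ M.ShareVertex τ s.2 := M.stencils_share τ s hs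
  have h0 := h τ ⟨0, 0, rfl⟩
  have p0 := M.h_pos τ
  have p1 := M.h_pos s.1
  have p2 := M.h_pos s.2
  have hC := h0.C_nonneg
  have key : ∀ m, |D.Sx n τ m| ≤ 8 * |C| / σ ∧ |D.Sy n τ m| ≤ 8 * |C| / σ := by
    intro m
    have d1 : |D.avg n s.1 m - D.avg n τ m| ≤ 2 * C * (M.h τ + M.h s.1 + M.h s.2) := by
      have e1 := (norm_le_pi_norm (D.avg n s.1 - D.avg n τ) m).trans
        (h0.norm_avg_sub_avg_le (h _ hs1) hs1 hD hn.le)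
      have e2 : 0 ≤ C * M.h s.2 := by positivity
      rw [Pi.sub_apply, Real.norm_eq_abs] at e1
      linarith
    have d2 : |D.avg n s.2 m - D.avg n τ m| ≤ 2 * C * (M.h τ + M.h s.1 + M.h s.2) := by
      have e1 := (norm_le_pi_norm (D.avg n s.2 - D.avg n τ) m).trans
        (h0.norm_avg_sub_avg_le (h _ hs2) hs2 hD hn.le)
      have e2 : 0 ≤ C * M.h s.1 := by positivity
      rw [Pi.sub_apply, Real.norm_eq_abs] at e1
      linarith
    obtain ⟨gx, gy, hx, hy, bx, bY⟩ := exists_gradient hσ (by positivity)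
      ((norm_ctr_sub_le_of_shareVertex hs1).trans (by linarith)) ((norm_ctr_sub_le_of_shareVertex hs2).trans (by linarith)) d1 d2 hdet
    have hmin := (hD.eno n hn τ m).2 s hs gx gy ⟨hx, hy⟩
    have hg : gx ^ 2 + gy ^ 2 ≤ (8 * |C| / σ) ^ 2 := by
      have e1 : gx ^ 2 ≤ (2 * (2 * C) / σ) ^ 2 := sq_le_sq' (abs_le.1 bx).1 (abs_le.1 bx).2
      have e2 : gy ^ 2 ≤ (2 * (2 * C) / σ) ^ 2 := sq_le_sq' (abs_le.1 bY).1 (abs_le.1 bY).2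
      have e3 : (8 * |C| / σ) ^ 2 = 4 * (2 * (2 * C) / σ) ^ 2 := by
        rw [abs_of_nonneg hC]; ring
      nlinarith [sq_nonneg (2 * (2 * C) / σ)]
    exact ⟨abs_le_of_sq_le_sq (by nlinarith [sq_nonneg (D.Sy n τ m)]) (by positivity),
      abs_le_of_sq_le_sq (by nlinarith [sq_nonneg (D.Sx n τ m)]) (by positivity)⟩
  exact ⟨(pi_norm_le_iff_of_nonneg (by positivity)).2 fun m => (key m).1,
    (pi_norm_le_iff_of_nonneg (by positivity)).2 fun m => (key m).2⟩

/-- The predictor stays close to the average over the time slab. -/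
theorem norm_pred_sub_avg_le {G κ : ℝ} (hK : S.CoeffBound (S.states b) K)
    (hv : D.avg n τ ∈ S.states b) (hx : ‖D.Sx n τ‖ ≤ G) (hy : ‖D.Sy n τ‖ ≤ G)
    (hdt : D.dt n ≤ κ * M.h τ) {x : Pt} (hxc : x ∈ M.cell τ) {t : ℝ}
    (ht : t ∈ Set.Icc (D.time n) (D.time (n + 1))) :
    ‖D.pred S n τ x t - D.avg n τ‖ ≤ (2 * κ * K * G + 2 * G) * M.h τ := by
  have hK0 := hK.nonneg
  have hG : 0 ≤ G := (norm_nonneg _).trans hx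
  rw [time_succ] at ht
  have hA := (mulVec_norm_le (S.A (D.avg n τ)) (D.Sx n τ)).trans
    (mul_le_mul (hK.matA.bdd _ hv) hx (norm_nonneg _) hK0)
  have hB := (mulVec_norm_le (S.B (D.avg n τ)) (D.Sy n τ)).trans
    (mul_le_mul (hK.matB.bdd _ hv) hy (norm_nonneg _) hK0)
  have hd := M.norm_sub_le_h hxc (M.ctr_mem τ)
  have h0 : ‖(x - M.ctr τ) 0 • D.Sx n τ‖ ≤ M.h τ * G := by
    rw [norm_smul]
    exact mul_le_mul ((HypSystem.abs_coord_le _ 0).trans hd) hx (norm_nonneg _) (M.h_pos τ).le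
  have h1 : ‖(x - M.ctr τ) 1 • D.Sy n τ‖ ≤ M.h τ * G := by
    rw [norm_smul]
    exact mul_le_mul ((HypSystem.abs_coord_le _ 1).trans hd) hy (norm_nonneg _) (M.h_pos τ).le
  have h2 : ‖(t - D.time n) • ((S.A (D.avg n τ)).mulVec (D.Sx n τ)
      + (S.B (D.avg n τ)).mulVec (D.Sy n τ))‖ ≤ κ * M.h τ * (2 * (K * G)) := by
    rw [norm_smul, Real.norm_of_nonneg (by linarith [ht.1])]
    refine mul_le_mul (by linarith [ht.2]) ((norm_add_le _ _).trans (by linarith))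
      (norm_nonneg _) (by linarith [ht.1, ht.2])
  have e : D.pred S n τ x t - D.avg n τ
      = -((t - D.time n) • ((S.A (D.avg n τ)).mulVec (D.Sx n τ)
        + (S.B (D.avg n τ)).mulVec (D.Sy n τ))) + (x - M.ctr τ) 0 • D.Sx n τ
        + (x - M.ctr τ) 1 • D.Sy n τ := by
    rw [pred]; abel
  rw [e]
  refine (norm_add_le _ _).trans ((add_le_add ((norm_add_le _ _).trans (add_le_add
    (norm_neg _).le le_rfl)) le_rfl).trans ?_)
  linarith

/-- Smoothness around a subcell provides the local bounds, with constants that depend on the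
system and on the regularity parameters only. -/
theorem exists_localBounds (S : HypSystem ν) (C C' κ b : ℝ) {σ : ℝ} (hσ : 0 < σ) :
    ∃ b' c : ℝ, ∀ {Ω : Set Pt} {M : Mesh Ω} {D : DiscreteData ν M}, M.ShapeRegular σ →
      D.IsScheme S → D.CFL κ → D.BoundedBy b → ∀ {n : ℕ}, n < D.nt → ∀ {τ : Fin M.nsub},
      D.SmoothAround C C' n τ → M.h τ ≤ 1 → LocalBounds S D b' c σ n τ := by
  obtain ⟨K, hK⟩ := S.exists_coeffBound b
  have hK0 := hK.nonneg
  set G := 8 * |C| / σ with hG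
  have hG0 : 0 ≤ G := by positivity
  set c₁ := 2 * |κ| * K * G + 2 * G with hc₁
  have hc₁0 : 0 ≤ c₁ := by positivity
  set c := G + |κ| + (c₁ + 2 * |C|) * (1 + σ⁻¹) + |C'| with hc
  have hσi : 0 < σ⁻¹ := inv_pos.2 hσ
  have hmul : 0 ≤ (c₁ + 2 * |C|) * (1 + σ⁻¹) := by positivity
  have hexp : (c₁ + 2 * |C|) * (1 + σ⁻¹) = c₁ + 2 * |C| + c₁ * σ⁻¹ + 2 * |C| * σ⁻¹ := by ring
  have q1 : 0 ≤ c₁ * σ⁻¹ := by positivity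
  have q2 : 0 ≤ |C| * σ⁻¹ := by positivity
  have q3 : 0 ≤ |C| := abs_nonneg C
  have q4 : 0 ≤ |C'| := abs_nonneg C'
  have q5 : 0 ≤ |κ| := abs_nonneg κ
  have hc0 : 0 ≤ c := by positivity
  refine ⟨b + c, c, ?_⟩
  intro Ω M D hM hD hκ hb n hn τ hs hh1
  have hh := M.h_pos τ
  have hself : ∀ τ', M.ShareVertex τ' τ' := fun τ' => ⟨0, 0, rfl⟩
  have hCC : |C| = C := abs_of_nonneg (hs τ ⟨τ, Or.inl rfl, hself τ⟩).C_nonneg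
  rw [← hCC] at hs
  have hsm : ∀ τ', M.ShareVertex τ τ' → D.SmoothAt |C| C' n τ' :=
    fun τ' h => hs τ' ⟨τ, Or.inl rfl, h⟩
  have hsm' : ∀ {k f}, M.adj τ k = some f → ∀ τ', M.ShareVertex f.1 τ' → D.SmoothAt |C| C' n τ' :=
    fun {k f} hf τ' h => hs τ' ⟨f.1, Or.inr ⟨k, f.2, hf⟩, h⟩
  have h0 := hsm τ (hself τ)
  have avgb : ∀ τ', D.avg n τ' ∈ S.states b := fun τ' => S.mem_states.2 ⟨hD.avg_adm hn τ', by
    simpa using hD.norm_avg_sub_le hn.le τ' (v := 0) (by simpa using hb n hn.le τ')⟩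
  have hcfl : ∀ τ', D.dt n ≤ |κ| * M.h τ' := fun τ' => (hκ n hn τ').trans
    (mul_le_mul_of_nonneg_right (le_abs_self κ) (M.h_pos τ').le)
  have grow : ∀ {v : State ν}, ‖v - D.avg n τ‖ ≤ c * M.h τ → ‖v‖ ≤ b + c := by
    intro v hv
    have h1 := norm_add_le (v - D.avg n τ) (D.avg n τ)
    rw [sub_add_cancel] at h1
    have h2 : c * M.h τ ≤ c := mul_le_of_le_one_right hc0 hh1
    linarith [(S.mem_states.1 (avgb τ)).2]
  obtain ⟨hsx, hsy⟩ := norm_slope_le hσ hM hD hn hsm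
  rw [abs_abs, ← hG] at hsx hsy
  have hpred : ∀ x ∈ M.cell τ, ∀ t ∈ Set.Icc (D.time n) (D.time (n + 1)),
      ‖D.pred S n τ x t - D.avg n τ‖ ≤ c₁ * M.h τ := fun x hx t ht =>
    norm_pred_sub_avg_le hK (avgb τ) hsx hsy (hcfl τ) hx ht
  have hvh : ∀ x ∈ M.cell τ, ‖D.vh n τ x - D.avg n τ‖ ≤ 2 * |C| * M.h τ := by
    intro x hx
    have e1 := h0.norm_vh_sub_le hx hx
    have e2 := h0.norm_avg_sub_le hD hn.le
    have e3 := norm_sub_le (D.vh n τ x - D.vh n τ (M.ctr τ)) (D.avg n τ - D.vh n τ (M.ctr τ))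
    rw [sub_sub_sub_cancel_right] at e3
    linarith
  have houter : ∀ k, ∀ x ∈ edge (M.vert τ) k, ∀ t ∈ Set.Icc (D.time n) (D.time (n + 1)),
      ‖D.outer S n τ k x t - D.avg n τ‖ ≤ c * M.h τ := by
    intro k x hx t ht
    rcases hf : M.adj τ k with _ | f
    · rw [outer_none hf]
      have e1 := h0.jump_bdry k hf x hx t ht
      have e2 := hvh x (M.edge_subset_cell τ k hx)
      have e3 := norm_add_le (D.ghost n τ k (x, t) - D.vh n τ x) (D.vh n τ x - D.avg n τ)
      rw [sub_add_sub_cancel] at e3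
      have e4 : C' * M.h τ ≤ |C'| * M.h τ := mul_le_mul_of_nonneg_right (le_abs_self _) hh.le
      have e5 : (2 * |C| + |C'|) * M.h τ ≤ c * M.h τ :=
        mul_le_mul_of_nonneg_right (by linarith) hh.le
      linarith
    · rw [outer_some hf]
      have hsf : M.ShareVertex τ f.1 :=
        ⟨k + 2, f.2 + 1, (M.adj_edge τ k f.1 f.2 hf).1.symm⟩
      obtain ⟨hfx, hfy⟩ := norm_slope_le hσ hM hD hn (hsm' hf)
      rw [abs_abs, ← hG] at hfx hfy
      have e1 := norm_pred_sub_avg_le hK (avgb f.1) hfx hfy (hcfl f.1)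
        (M.edge_subset_cell_of_adj hf hx) ht
      have e2 := h0.norm_avg_sub_avg_le (hsm _ hsf) hsf hD hn.le
      have e3 := norm_add_le (D.pred S n f.1 x t - D.avg n f.1) (D.avg n f.1 - D.avg n τ)
      rw [sub_add_sub_cancel] at e3
      have e4 := M.h_le_of_adj hσ hM hf
      have e5 : (c₁ + 2 * |C|) * M.h f.1 ≤ (c₁ + 2 * |C|) * (σ⁻¹ * M.h τ) :=
        mul_le_mul_of_nonneg_left e4 (by positivity)
      have e6 : (2 * |C| + (c₁ + 2 * |C|) * σ⁻¹) * M.h τ ≤ c * M.h τ :=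
        mul_le_mul_of_nonneg_right (by linarith) hh.le
      linarith
  have hpred' : ∀ x ∈ M.cell τ, ∀ t ∈ Set.Icc (D.time n) (D.time (n + 1)),
      ‖D.pred S n τ x t - D.avg n τ‖ ≤ c * M.h τ := fun x hx t ht =>
    (hpred x hx t ht).trans (mul_le_mul_of_nonneg_right (by linarith) hh.le)
  exact
    { avg_mem := S.mem_states.2 ⟨(avgb τ).1, (S.mem_states.1 (avgb τ)).2.trans (by linarith)⟩
      slope_x := hsx.trans (by linarith)
      slope_y := hsy.trans (by linarith)
      pred_mem := fun x hx t ht =>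
        S.mem_states.2 ⟨hD.pred_adm n hn τ x hx t ht, grow (hpred' x hx t ht)⟩
      pred_near := hpred'
      outer_mem := fun k x hx t ht =>
        S.mem_states.2 ⟨hD.outer_adm hn τ k hx ht, grow (houter k x hx t ht)⟩
      outer_near := houter
      vh_mem := fun x hx =>
        S.mem_states.2 ⟨hD.vh_adm n hn.le τ x hx, (hb n hn.le τ x hx).trans (by linarith)⟩
      vh_succ_mem := fun x hx =>
        S.mem_states.2 ⟨hD.vh_adm (n + 1) hn τ x hx, (hb (n + 1) hn τ x hx).trans (by linarith)⟩
      vh_near := fun x hx => (hvh x hx).trans (mul_le_mul_of_nonneg_right (by linarith) hh.le)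
      dt_pos := hD.dt_pos n hn
      dt_le := (hcfl τ).trans (mul_le_mul_of_nonneg_right (by linarith) hh.le)
      vol_ge := hM.subcell τ
      h_le_one := hh1 }

/-- Where the discrete solution is smooth, the subcell defect is of first order, uniformly. -/
theorem exists_norm_defectSub_le (S : HypSystem ν) (C C' κ b : ℝ) {σ : ℝ} (hσ : 0 < σ) :
    ∃ K : ℝ, ∀ {Ω : Set Pt} {M : Mesh Ω} {D : DiscreteData ν M}, M.ShapeRegular σ →
      D.IsScheme S → D.CFL κ → D.BoundedBy b → ∀ {n : ℕ}, n < D.nt → ∀ {τ : Fin M.nsub},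
      D.SmoothAround C C' n τ → M.h τ ≤ 1 →
      ‖D.defectSub S S.upwindFlux n τ‖ ≤ K * M.h τ := by
  obtain ⟨b', c, H⟩ := exists_localBounds S C C' κ b hσ
  obtain ⟨K, hK⟩ := S.exists_coeffBound b'
  exact ⟨_, fun hM hD hκ hb _ hn _ hs hh =>
    (H hM hD hκ hb hn hs hh).norm_defectSub_le hσ hK hD hn rfl⟩

end DiscreteData

end Defect

end QuasiCons


theorem proposition3 {ν : ℕ} (S : HypSystem ν) :
    ∃ flux : State ν → State ν → Pt → State ν, S.IsNumericalFlux flux ∧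
      ∀ (Ω : Set Pt), IsOpen Ω → Bornology.IsBounded Ω →
      ∀ (C C' σ κ b : ℝ), 0 < σ →
      ∀ (M : ℕ → Mesh Ω) (D : ∀ j, DiscreteData ν (M j)),
        (∀ j, (M j).ShapeRegular σ) →
        Tendsto (fun j => (M j).size) atTop (𝓝 0) →
        (∀ j, (D j).IsScheme S) →
        (∀ j, (D j).CFL κ) →
        (∀ j, (D j).BoundedBy b) →
        -- the subcell update satisfies the local balance with the subcell defect
        (∀ j, ∀ n < (D j).nt, ∀ τ,
          (D j).BalanceSub S flux n τ ((D j).defectSub S flux n τ)) ∧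
        -- where the discrete solution is smooth the subcell defect is `o(1)`
        (∀ ε > 0, ∀ᶠ j in atTop, ∀ n < (D j).nt, ∀ τ, (D j).SmoothAround C C' n τ →
          ‖(D j).defectSub S flux n τ‖ ≤ ε) ∧
        -- the cell balance with the area-weighted defect
        (∀ j, ∀ n < (D j).nt, ∀ i,
          (D j).BalanceCell S flux n i ((D j).defectCell S flux n i)) ∧
        -- cells with smoothness on all the subcells: the cell defect is `o(1)`
        (∀ ε > 0, ∀ᶠ j in atTop, ∀ n < (D j).nt, ∀ i,
          (∀ τ ∈ (M j).subs i, (D j).SmoothAround C C' n τ) →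
            ‖(D j).defectCell S flux n i‖ ≤ ε) ∧
        -- smoothness everywhere: the scheme is quasi-conservative
        ((∀ j, ∀ n < (D j).nt, ∀ τ, (D j).SmoothAt C C' n τ) →
          IsQuasiConservative S flux M D) := by
  refine ⟨S.upwindFlux, S.isNumericalFlux_upwindFlux, ?_⟩
  intro Ω _ _ C C' σ κ b hσ M D hM hsize hD hκ hb
  have hflux := S.isNumericalFlux_upwindFlux
  obtain ⟨K, hK⟩ := DiscreteData.exists_norm_defectSub_le S C C' κ b hσ
  have hsub : ∀ ε > 0, ∀ᶠ j in atTop, ∀ n < (D j).nt, ∀ τ, (D j).SmoothAround C C' n τ →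
      ‖(D j).defectSub S S.upwindFlux n τ‖ ≤ ε := by
    intro ε hε
    have hδ : 0 < min 1 (ε / (|K| + 1)) := by positivity
    filter_upwards [hsize.eventually (gt_mem_nhds hδ)] with j hj n hn τ hs
    have h1 := ((M j).h_le_size τ).trans hj.le
    have h2 := (M j).h_pos τ
    have h3 := h1.trans (min_le_right _ _)
    rw [le_div_iff₀ (by positivity)] at h3
    refine (hK (hM j) (hD j) (hκ j) (hb j) hn hs (h1.trans (min_le_left _ _))).trans ?_
    nlinarith [le_abs_self K]
  have hcell : ∀ ε > 0, ∀ᶠ j in atTop, ∀ n < (D j).nt, ∀ i,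
      (∀ τ ∈ (M j).subs i, (D j).SmoothAround C C' n τ) →
        ‖(D j).defectCell S S.upwindFlux n i‖ ≤ ε := by
    intro ε hε
    filter_upwards [hsub ε hε] with j hj n hn i hs
    exact DiscreteData.norm_defectCell_le (le_of_lt hε) fun τ hτ => hj n hn τ (hs τ hτ)
  have hbal : ∀ j, ∀ n < (D j).nt, ∀ i,
      (D j).BalanceCell S S.upwindFlux n i ((D j).defectCell S S.upwindFlux n i) :=
    fun j n hn i => (hD j).balanceCell hflux hn i
  refine ⟨fun j n hn τ => (hD j).balanceSub hn τ, hsub, hbal, hcell, fun hsm => ⟨hflux,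
    fun j n i => (D j).defectCell S S.upwindFlux n i, hbal, fun ε hε => ?_⟩⟩
  filter_upwards [hcell ε hε] with j hj n hn i
  exact hj n hn i fun τ _ τ' _ => hsm j n hn τ'
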